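/- Let $a,b,c,d$ be nonnegative integers with $S:=a+b=c+d$, $bc\neq 0$, and put $m:=a-c=d-b$, $\sigma:=m/S$; assume that $\sigma>\tfrac12$ (the urn is balanced, non-triangular and large). Let $(\alpha,\beta)\in\mathbb N^2\setminus\{(0,0)\}$ and let $(U_{(\alpha,\beta)}(n))_{n\ge 0}$ be the composition process of the two-color Pólya urn with initial composition $(\alpha,\beta)$ and replacement matrix $\begin{pmatrix}a&b\\c&d\end{pmatrix}$, that is, the $\mathbb N^2$-valued Markov chain with $U_{(\alpha,\beta)}(0)=(\alpha,\beta)$ that jumps from $(x,y)$ to $(x+a,y+b)$ with probability $\frac{x}{x+y}$ and to $(x+c,y+d)$ with probability $\frac{y}{x+y}$. Let $u_2(x,y)=\frac1S(bx-cy)$. Then the limit $$W^{DT}_{(\alpha,\beta)}:=\lim_{n\to\infty}\frac{1}{n^{\sigma}}\,u_2\bigl(U_{(\alpha,\beta)}(n)\bigr)$$ exists almost surely, the law of the real random variable $W^{DT}_{(\alpha,\beta)}$ has a bounded and continuous density with respect to Lebesgue measure on $\mathbb R$, and its support is the whole real line $\mathbb R$. -/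

import Mathlib

open Filter Topology MeasureTheory

noncomputable section

namespace PolyaUrn

/-- Probability that an urn of composition `u = (red, black)` becomes `v` after one drawing, for
the replacement matrix with rows `(a, b)` and `(c, d)`: a ball is drawn uniformly; if it is red,
`a` red and `b` black balls are added, if it is black, `c` red and `d` black balls are added. -/
def transition (a b c d : ℕ) (u v : ℕ × ℕ) : ℝ :=
  (u.1 : ℝ) / ((u.1 : ℝ) + (u.2 : ℝ)) * (if v = u + (a, b) then 1 else 0) +
    (u.2 : ℝ) / ((u.1 : ℝ) + (u.2 : ℝ)) * (if v = u + (c, d) then 1 else 0)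

/-- `U` is, on the probability space `(Ω, μ)`, the composition process of the discrete-time
two-color Pólya urn with replacement matrix rows `(a, b)`, `(c, d)` and initial composition
`(α, β)`: it is the `ℕ²`-valued Markov chain started at `(α, β)` with the above transition
probabilities. -/
structure IsProcess {Ω : Type*} [MeasurableSpace Ω] (μ : Measure Ω) (a b c d α β : ℕ)
    (U : ℕ → Ω → ℕ × ℕ) : Prop where
  measurable : ∀ n, Measurable (U n)
  init : ∀ᵐ ω ∂μ, U 0 ω = (α, β)
  markov : ∀ (n : ℕ) (h : ℕ → ℕ × ℕ) (v : ℕ × ℕ),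
    μ.real {ω | (∀ k ≤ n, U k ω = h k) ∧ U (n + 1) ω = v} =
      μ.real {ω | ∀ k ≤ n, U k ω = h k} * transition a b c d (h n) v

/-- The ratio `σ = m / S` of the eigenvalues `m = a - c` and `S = a + b` of a balanced replacement
matrix with rows `(a, b)` and `(c, d)`. -/
def ratio (a b c : ℕ) : ℝ := ((a : ℝ) - (c : ℝ)) / ((a : ℝ) + (b : ℝ))

/-- The linear form `u₂ (x, y) = (b x - c y) / S`, where `S = a + b`. -/
def u₂ (a b c : ℕ) (u : ℕ × ℕ) : ℝ :=
  ((b : ℝ) * (u.1 : ℝ) - (c : ℝ) * (u.2 : ℝ)) / ((a : ℝ) + (b : ℝ))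

/-- `W` is a version of the limit variable `W^{DT}` of the process `U`: almost surely,
`W = lim_n u₂ (U n) / n ^ σ`. -/
def IsLimit {Ω : Type*} [MeasurableSpace Ω] (μ : Measure Ω) (a b c : ℕ)
    (U : ℕ → Ω → ℕ × ℕ) (W : Ω → ℝ) : Prop :=
  Measurable W ∧
    ∀ᵐ ω ∂μ, Tendsto (fun n : ℕ => u₂ a b c (U n ω) / (n : ℝ) ^ ratio a b c) atTop (𝓝 (W ω))

end PolyaUrn

end

/-!
Let `p` be the mass of the initial composition `u` in units of `S` and `σ = m / S`. Rescaled by its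
mean growth, of order `n ^ σ`, `u₂` of the composition at time `n` is a martingale. Its increments
have second moments of order `n ^ (-2 * σ)`, summable because `σ > 1 / 2`, so it converges almost
surely and in `L²`.

For the density, let `φ_u` be the characteristic function of the limit. The exponential generating
function of the iterates of the transition operator on `exp (i θ u₂)`, weighted by the rising
factorials of the mass, is multiplicative in the initial composition, because the balls of an urn
reproduce independently in continuous time. Passing to the limit, `|φ_{v + w} t|` is bounded by a
constant times `∫ s in 0..1, |φ_v (s ^ σ * t)| * |φ_w ((1 - s) ^ σ * t)|`. For the maximum `χ r` of
`|φ_u (r ^ σ)|` over urns of mass one this gives `r * χ r ≤ (χ ⋆ χ) r`, hence `-X' ≤ X ^ 2` for its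
Laplace transform `X`. So `z - 1 / X z` is monotone, which together with `X 1 < 1` keeps `X` bounded
at `0`: `χ` is integrable, and the convolution inequality then yields `χ r = O(1 / r)`, that is
`φ_u t = O(|t| ^ (-1 / σ))`. As `σ < 1`, `φ_u` is integrable and Fourier inversion gives the
density.

For the support, the rescaled compositions reachable with positive probability at time `n` get
arbitrarily close to any real number, while conditionally on the composition at time `n` the limit
has a variance bounded by the tail `∑ k ≥ n, k ^ (-2 * σ)`, up to a constant.
-/

namespace PolyaUrn

section FourierInversion

open scoped FourierTransform SchwartzMap

theorem locallyIntegrable_rnDeriv_smul {X F : Type*} [TopologicalSpace X] [T2Space X]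
    [LocallyCompactSpace X] [MeasurableSpace X] [OpensMeasurableSpace X] [NormedAddCommGroup F]
    [NormedSpace ℝ F] {μ ν : Measure X} [SigmaFinite μ] [SigmaFinite ν] (hμν : μ ≪ ν)
    {f : X → F} (hf : LocallyIntegrable f μ) :
    LocallyIntegrable (fun x => (μ.rnDeriv ν x).toReal • f x) ν := by
  rw [locallyIntegrable_iff]
  intro K hK
  have hK' := hf.integrableOn_isCompact hK
  rw [← integrable_indicator_iff hK.measurableSet] at hK' ⊢
  simpa only [Set.indicator_smul] using (integrable_rnDeriv_smul_iff hμν).2 hK'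

theorem ae_nonneg_and_eq_withDensity_of_integral_contDiff_eq {E : Type*} [NormedAddCommGroup E]
    [NormedSpace ℝ E] [FiniteDimensional ℝ E] [MeasurableSpace E] [BorelSpace E]
    {μ ν : Measure E} [IsLocallyFiniteMeasure μ] [IsLocallyFiniteMeasure ν] {f : E → ℝ}
    (hfm : Measurable f) (hf : LocallyIntegrable f ν)
    (h : ∀ g : E → ℝ, ContDiff ℝ (⊤ : ℕ∞) g → HasCompactSupport g →
      ∫ x, g x ∂μ = ∫ x, g x * f x ∂ν) :
    0 ≤ᵐ[ν] f ∧ μ = ν.withDensity (fun x => ENNReal.ofReal (f x)) := by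
  have hμ : μ ≪ μ + ν := Measure.absolutelyContinuous_of_le (Measure.le_add_right le_rfl)
  have hν : ν ≪ μ + ν := Measure.absolutelyContinuous_of_le (Measure.le_add_left le_rfl)
  have heq : ∀ᵐ x ∂(μ + ν),
      (μ.rnDeriv (μ + ν) x).toReal • (1 : ℝ) = (ν.rnDeriv (μ + ν) x).toReal • f x := by
    refine ae_eq_of_integral_contDiff_smul_eq
      (locallyIntegrable_rnDeriv_smul hμ (locallyIntegrable_const 1))
      (locallyIntegrable_rnDeriv_smul hν hf) fun g hg hgc => ?_
    calc ∫ x, g x • (μ.rnDeriv (μ + ν) x).toReal • (1 : ℝ) ∂(μ + ν)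
        = ∫ x, g x ∂μ := by
          rw [← integral_rnDeriv_smul hμ]
          simp only [smul_eq_mul, mul_one, mul_comm (g _)]
      _ = ∫ x, g x * f x ∂ν := h g hg hgc
      _ = ∫ x, g x • (ν.rnDeriv (μ + ν) x).toReal • f x ∂(μ + ν) := by
          rw [← integral_rnDeriv_smul hν]
          simp only [smul_eq_mul, mul_left_comm]
  simp only [smul_eq_mul, mul_one] at heq
  constructor
  · filter_upwards [hν.ae_le heq, Measure.rnDeriv_pos hν,
      hν.ae_le (Measure.rnDeriv_lt_top ν (μ + ν))] with x hx hpos hlt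
    exact nonneg_of_mul_nonneg_right (hx ▸ ENNReal.toReal_nonneg)
      (ENNReal.toReal_pos hpos.ne' hlt.ne)
  · calc μ = (μ + ν).withDensity (μ.rnDeriv (μ + ν)) :=
          (Measure.withDensity_rnDeriv_eq _ _ hμ).symm
      _ = (μ + ν).withDensity (ν.rnDeriv (μ + ν) * fun x => ENNReal.ofReal (f x)) := by
          refine withDensity_congr_ae ?_
          filter_upwards [heq, Measure.rnDeriv_lt_top μ (μ + ν), Measure.rnDeriv_lt_top ν (μ + ν)]
            with x hx hlt hlt'
          rw [Pi.mul_apply, ← ENNReal.ofReal_toReal hlt.ne, hx,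
            ENNReal.ofReal_mul ENNReal.toReal_nonneg, ENNReal.ofReal_toReal hlt'.ne]
      _ = ν.withDensity (fun x => ENNReal.ofReal (f x)) := by
          rw [withDensity_mul _ (Measure.measurable_rnDeriv _ _) hfm.ennreal_ofReal,
            Measure.withDensity_rnDeriv_eq _ _ hν]

variable {E : Type*} [NormedAddCommGroup E] [InnerProductSpace ℝ E] [MeasurableSpace E]

theorem charFun_two_pi_smul_eq_fourierIntegral (μ : Measure E) (ξ : E) :
    charFun μ ((2 * Real.pi) • ξ) =
      VectorFourier.fourierIntegral Real.fourierChar μ (-innerₗ E) 1 ξ := by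
  have h : (2 * Real.pi)⁻¹ * (2 * Real.pi) = 1 := inv_mul_cancel₀ Real.two_pi_pos.ne'
  rw [charFun_eq_fourierIntegral', smul_smul, neg_mul, h]
  simp [VectorFourier.fourierIntegral]

variable [FiniteDimensional ℝ E] [BorelSpace E]

/-- The Fourier inversion formula for the density of `μ`. The dilation by `2π` accounts for the
kernel `exp (-2πi⟪x, ξ⟫)` of `𝓕`, as opposed to the kernel `exp (i⟪x, ξ⟫)` of `charFun`. -/
noncomputable def fourierDensity (μ : Measure E) : E → ℂ :=
  𝓕 (fun ξ : E => charFun μ ((2 * Real.pi) • ξ))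

theorem integrable_charFun_two_pi_smul {μ : Measure E} (hμ : Integrable (charFun μ)) :
    Integrable (fun ξ : E => charFun μ ((2 * Real.pi) • ξ)) :=
  hμ.comp_smul (by positivity)

theorem continuous_fourierDensity {μ : Measure E} (hμ : Integrable (charFun μ)) :
    Continuous (fourierDensity μ) :=
  VectorFourier.fourierIntegral_continuous Real.continuous_fourierChar continuous_inner
    (integrable_charFun_two_pi_smul hμ)

theorem norm_fourierDensity_le (μ : Measure E) (x : E) :
    ‖fourierDensity μ x‖ ≤ ∫ ξ : E, ‖charFun μ ((2 * Real.pi) • ξ)‖ :=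
  VectorFourier.norm_fourierIntegral_le_integral_norm ..

theorem integral_schwartz_eq_integral_mul_fourierDensity {μ : Measure E} [IsFiniteMeasure μ]
    (hμ : Integrable (charFun μ)) (g : 𝓢(E, ℂ)) :
    ∫ x, g x ∂μ = ∫ x, g x * fourierDensity μ x := by
  have hcont : Continuous fun p : E × E => innerₗ E p.1 p.2 := continuous_inner
  have hinv (x : E) : g x =
      VectorFourier.fourierIntegral Real.fourierChar volume (-innerₗ E) (𝓕 g : 𝓢(E, ℂ)) x := by
    have h : (𝓕⁻ (𝓕 g) : 𝓢(E, ℂ)) x = g x := by rw [FourierTransform.fourierInv_fourier_eq]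
    rw [← h, SchwartzMap.fourierInv_coe, Real.fourierInv_eq]
    simp [VectorFourier.fourierIntegral]
  calc ∫ x, g x ∂μ
      = ∫ x, VectorFourier.fourierIntegral Real.fourierChar volume (-innerₗ E)
          (𝓕 g : 𝓢(E, ℂ)) x • (1 : E → ℂ) x ∂μ := by
        simp only [← hinv, Pi.one_apply, smul_eq_mul, mul_one]
    _ = ∫ ξ, (𝓕 g : 𝓢(E, ℂ)) ξ • charFun μ ((2 * Real.pi) • ξ) := by
        simp only [charFun_two_pi_smul_eq_fourierIntegral]
        have h := VectorFourier.integral_fourierIntegral_smul_eq_flip (L := -innerₗ E)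
          (μ := volume) (g := (1 : E → ℂ)) Real.continuous_fourierChar hcont.neg
          (𝓕 g : 𝓢(E, ℂ)).integrable (integrable_const (μ := μ) 1)
        rwa [show (-innerₗ E).flip = -innerₗ E from congrArg Neg.neg (flip_innerₗ E)] at h
    _ = ∫ x, g x * fourierDensity μ x := by
        have h := VectorFourier.integral_fourierIntegral_smul_eq_flip (L := innerₗ E) (μ := volume)
          Real.continuous_fourierChar hcont g.integrable (integrable_charFun_two_pi_smul hμ)
        rwa [flip_innerₗ] at h

theorem integral_contDiff_eq_integral_mul_fourierDensity_re {μ : Measure E} [IsFiniteMeasure μ]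
    (hμ : Integrable (charFun μ)) {g : E → ℝ} (hg : ContDiff ℝ (⊤ : ℕ∞) g)
    (hgc : HasCompactSupport g) :
    ∫ x, g x ∂μ = ∫ x, g x * (fourierDensity μ x).re := by
  have hc : HasCompactSupport fun x => (g x : ℂ) := hgc.comp_left Complex.ofReal_zero
  have hs : ContDiff ℝ (⊤ : ℕ∞) fun x => (g x : ℂ) := Complex.ofRealCLM.contDiff.comp hg
  have hint : Integrable fun x => (g x : ℂ) * fourierDensity μ x :=
    (hs.continuous.mul (continuous_fourierDensity hμ)).integrable_of_hasCompactSupport hc.mul_right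
  have h := congrArg Complex.re
    (integral_schwartz_eq_integral_mul_fourierDensity hμ (hc.toSchwartzMap hs))
  simp only [HasCompactSupport.toSchwartzMap_toFun, integral_complex_ofReal] at h
  simpa using h.trans (integral_re hint).symm

theorem exists_continuous_density_of_integrable_charFun {μ : Measure E} [IsFiniteMeasure μ]
    (hμ : Integrable (charFun μ)) :
    ∃ f : E → ℝ, Continuous f ∧ (∀ x, 0 ≤ f x) ∧ (∃ C : ℝ, ∀ x, f x ≤ C) ∧
      μ = volume.withDensity (fun x => ENNReal.ofReal (f x)) := by
  have hcont : Continuous fun x => (fourierDensity μ x).re :=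
    Complex.continuous_re.comp (continuous_fourierDensity hμ)
  obtain ⟨hnonneg, hdensity⟩ := ae_nonneg_and_eq_withDensity_of_integral_contDiff_eq
    hcont.measurable hcont.locallyIntegrable fun _ =>
      integral_contDiff_eq_integral_mul_fourierDensity_re hμ
  refine ⟨_, hcont, fun x => ?_,
    ⟨_, fun x => (Complex.re_le_norm _).trans (norm_fourierDensity_le μ x)⟩, hdensity⟩
  exact Set.eq_univ_iff_forall.1 ((isClosed_le continuous_const hcont).ae_eq_univ_iff_eq.1
    (eventuallyEq_univ.2 hnonneg)) x

end FourierInversion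

section Laplace

/-- The Laplace transform of `χ`, used to prove that `χ` is integrable on `(0, ∞)` by bounding it
near `0`. -/
noncomputable def laplace (χ : ℝ → ℝ) (z : ℝ) : ℝ :=
  ∫ x in Set.Ioi 0, Real.exp (-z * x) * χ x

variable {χ : ℝ → ℝ} {z : ℝ}

theorem integrableOn_exp_neg_mul_mul (hχ : Measurable χ) (h0 : ∀ x, 0 ≤ χ x) (h1 : ∀ x, χ x ≤ 1)
    (hz : 0 < z) : IntegrableOn (fun x => Real.exp (-z * x) * χ x) (Set.Ioi 0) :=
  (exp_neg_integrableOn_Ioi 0 hz).mul_bdd (c := 1) hχ.aestronglyMeasurable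
    (.of_forall fun x => by rw [Real.norm_of_nonneg (h0 x)]; exact h1 x)

theorem integrableOn_Ioc_of_mem_Icc (hχ : Measurable χ) (h0 : ∀ x, 0 ≤ χ x) (h1 : ∀ x, χ x ≤ 1)
    (x y : ℝ) : IntegrableOn χ (Set.Ioc x y) :=
  Measure.integrableOn_of_bounded (M := 1) measure_Ioc_lt_top.ne hχ.aestronglyMeasurable
    (.of_forall fun x => by rw [Real.norm_of_nonneg (h0 x)]; exact h1 x)

theorem laplace_pos (hχ : Measurable χ) (h0 : ∀ x, 0 ≤ χ x) (h1 : ∀ x, χ x ≤ 1)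
    (hne : ¬ χ =ᵐ[volume.restrict (Set.Ioi 0)] 0) (hz : 0 < z) : 0 < laplace χ z := by
  have hnonneg (x : ℝ) : 0 ≤ Real.exp (-z * x) * χ x := mul_nonneg (Real.exp_pos _).le (h0 x)
  refine (integral_nonneg hnonneg).lt_of_ne' fun h => hne ?_
  filter_upwards [(integral_eq_zero_iff_of_nonneg hnonneg
    (integrableOn_exp_neg_mul_mul hχ h0 h1 hz)).1 h] with x hx
  exact (mul_eq_zero.1 hx).resolve_left (Real.exp_pos _).ne'

theorem laplace_one_lt_one (hχ : Measurable χ) (h0 : ∀ x, 0 ≤ χ x) (h1 : ∀ x, χ x ≤ 1)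
    (hne : ¬ χ =ᵐ[volume.restrict (Set.Ioi 0)] 1) : laplace χ 1 < 1 := by
  have hm : Measurable (1 - χ) := measurable_const.sub hχ
  have h0' (x : ℝ) : 0 ≤ (1 - χ) x := sub_nonneg.2 (h1 x)
  have h1' (x : ℝ) : (1 - χ) x ≤ 1 := sub_le_self _ (h0 x)
  have hpos : 0 < laplace (1 - χ) 1 := laplace_pos hm h0' h1'
    (fun h => hne (h.mono fun x hx => (sub_eq_zero.1 hx).symm)) one_pos
  have hadd : laplace χ 1 + laplace (1 - χ) 1 = 1 := by
    rw [laplace, laplace, ← integral_add (integrableOn_exp_neg_mul_mul hχ h0 h1 one_pos)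
      (integrableOn_exp_neg_mul_mul hm h0' h1' one_pos)]
    simp [← mul_add, integral_exp_Iic_zero]
  linarith

theorem hasDerivAt_laplace (hχ : Measurable χ) (h0 : ∀ x, 0 ≤ χ x) (h1 : ∀ x, χ x ≤ 1)
    (hz : 0 < z) : IntegrableOn (fun x => Real.exp (-z * x) * (x * χ x)) (Set.Ioi 0) ∧
      HasDerivAt (laplace χ) (-laplace (fun x => x * χ x) z) z := by
  have hbound : IntegrableOn (fun x : ℝ => x * Real.exp (-(z / 2) * x)) (Set.Ioi 0) := by
    simpa using integrableOn_rpow_mul_exp_neg_mul_rpow (p := 1) (s := 1) (b := z / 2) (by norm_num)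
      one_pos (by positivity)
  have hderiv := hasDerivAt_integral_of_dominated_loc_of_deriv_le
    (F := fun y x => Real.exp (-y * x) * χ x) (F' := fun y x => -(Real.exp (-y * x) * (x * χ x)))
    (μ := volume.restrict (Set.Ioi 0)) (Ioi_mem_nhds (half_lt_self hz))
    (.of_forall fun y => by fun_prop) (integrableOn_exp_neg_mul_mul hχ h0 h1 hz) (by fun_prop)
    (bound := fun x => x * Real.exp (-(z / 2) * x)) ?_ hbound (.of_forall fun x y _ => ?_)
  · exact ⟨hderiv.1.neg.congr (.of_forall fun x => neg_neg _),
      hderiv.2.congr_deriv (integral_neg _)⟩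
  · refine (ae_restrict_iff' measurableSet_Ioi).2 (.of_forall fun x (hx : 0 < x) y
      (hy : z / 2 < y) => ?_)
    rw [norm_neg, Real.norm_of_nonneg (by have := h0 x; positivity)]
    calc Real.exp (-y * x) * (x * χ x) = x * (Real.exp (-y * x) * χ x) := by ring
      _ ≤ x * (Real.exp (-y * x) * 1) := by gcongr; exact h1 x
      _ ≤ x * Real.exp (-(z / 2) * x) := by rw [mul_one]; gcongr
  · have hlin : HasDerivAt (fun y : ℝ => -y * x) (-x) y := by
      simpa using ((hasDerivAt_id y).neg).mul_const x
    exact (hlin.exp.mul_const (χ x)).congr_deriv (by ring)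

theorem laplace_id_mul_le_sq (hχ : Measurable χ) (h0 : ∀ x, 0 ≤ χ x) (h1 : ∀ x, χ x ≤ 1)
    (hconv : ∀ r, 0 < r → r * χ r ≤ ∫ s in (0 : ℝ)..r, χ s * χ (r - s)) (hz : 0 < z) :
    laplace (fun x => x * χ x) z ≤ laplace χ z ^ 2 := by
  have hint := integrableOn_exp_neg_mul_mul hχ h0 h1 hz
  have hexp (x t : ℝ) : Real.exp (-z * t) * χ t * (Real.exp (-z * (x - t)) * χ (x - t)) =
      Real.exp (-z * x) * (χ t * χ (x - t)) := by
    rw [show -z * x = -z * t + -z * (x - t) by ring, Real.exp_add]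
    ring
  have hprod := integral_posConvolution hint hint (ContinuousLinearMap.mul ℝ ℝ)
  have hintegrable := integrable_posConvolution hint hint (ContinuousLinearMap.mul ℝ ℝ)
  rw [posConvolution, integrable_indicator_iff measurableSet_Ioi] at hintegrable
  simp only [ContinuousLinearMap.mul_apply', hexp, intervalIntegral.integral_const_mul]
    at hprod hintegrable
  rw [sq, laplace, laplace, ← hprod]
  exact setIntegral_mono_on (hasDerivAt_laplace hχ h0 h1 hz).1 hintegrable measurableSet_Ioi
    fun x hx => mul_le_mul_of_nonneg_left (hconv x hx) (Real.exp_pos _).le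

theorem monotoneOn_sub_inv_laplace (hχ : Measurable χ) (h0 : ∀ x, 0 ≤ χ x) (h1 : ∀ x, χ x ≤ 1)
    (hne : ¬ χ =ᵐ[volume.restrict (Set.Ioi 0)] 0)
    (hconv : ∀ r, 0 < r → r * χ r ≤ ∫ s in (0 : ℝ)..r, χ s * χ (r - s)) :
    MonotoneOn (fun z => z - (laplace χ z)⁻¹) (Set.Ioi 0) := by
  have hderiv (z : ℝ) (hz : 0 < z) : HasDerivAt (fun z => z - (laplace χ z)⁻¹)
      (1 - laplace (fun x => x * χ x) z / laplace χ z ^ 2) z :=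
    ((hasDerivAt_id z).sub
      ((hasDerivAt_laplace hχ h0 h1 hz).2.inv (laplace_pos hχ h0 h1 hne hz).ne')).congr_deriv
      (by rw [neg_neg])
  refine monotoneOn_of_deriv_nonneg (convex_Ioi 0)
    (fun z hz => (hderiv z hz).continuousAt.continuousWithinAt)
    (fun z hz => (hderiv z (interior_subset hz)).differentiableAt.differentiableWithinAt)
    fun z hz => ?_
  have hz' : 0 < z := interior_subset hz
  rw [(hderiv z hz').deriv, sub_nonneg, div_le_one (pow_pos (laplace_pos hχ h0 h1 hne hz') 2)]
  exact laplace_id_mul_le_sq hχ h0 h1 hconv hz'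

theorem exists_laplace_le (hχ : Measurable χ) (h0 : ∀ x, 0 ≤ χ x) (h1 : ∀ x, χ x ≤ 1)
    (hne : ¬ χ =ᵐ[volume.restrict (Set.Ioi 0)] 1)
    (hconv : ∀ r, 0 < r → r * χ r ≤ ∫ s in (0 : ℝ)..r, χ s * χ (r - s)) :
    ∃ C, ∀ z ∈ Set.Ioc (0 : ℝ) 1, laplace χ z ≤ C := by
  by_cases hzero : χ =ᵐ[volume.restrict (Set.Ioi 0)] 0
  · exact ⟨0, fun z _ => (integral_eq_zero_of_ae
      (hzero.mono fun x hx => mul_eq_zero_of_right _ hx)).le⟩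
  · have hpos (z : ℝ) (hz : 0 < z) := laplace_pos hχ h0 h1 hzero hz
    have hgap : 0 < (laplace χ 1)⁻¹ - 1 :=
      sub_pos.2 ((one_lt_inv₀ (hpos 1 one_pos)).2 (laplace_one_lt_one hχ h0 h1 hne))
    refine ⟨((laplace χ 1)⁻¹ - 1)⁻¹, fun z hz => ?_⟩
    have hmono : z - (laplace χ z)⁻¹ ≤ 1 - (laplace χ 1)⁻¹ :=
      monotoneOn_sub_inv_laplace hχ h0 h1 hzero hconv hz.1 (Set.mem_Ioi.2 one_pos) hz.2
    rw [le_inv_comm₀ (hpos z hz.1) hgap]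
    linarith [hz.1]

theorem intervalIntegral_le_exp_one_mul_laplace (hχ : Measurable χ) (h0 : ∀ x, 0 ≤ χ x)
    (h1 : ∀ x, χ x ≤ 1) {R : ℝ} (hR : 0 < R) :
    ∫ x in (0 : ℝ)..R, χ x ≤ Real.exp 1 * laplace χ R⁻¹ := by
  have hint := (integrableOn_exp_neg_mul_mul hχ h0 h1 (inv_pos.2 hR)).const_mul (Real.exp 1)
  have hle : ∀ x ∈ Set.Ioc 0 R, χ x ≤ Real.exp 1 * (Real.exp (-R⁻¹ * x) * χ x) := fun x hx => by
    rw [← mul_assoc, ← Real.exp_add]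
    refine le_mul_of_one_le_left (h0 x) (Real.one_le_exp ?_)
    rw [neg_mul, inv_mul_eq_div]
    linarith [(div_le_one hR).2 hx.2]
  rw [intervalIntegral.integral_of_le hR.le, laplace, ← integral_const_mul]
  calc ∫ x in Set.Ioc 0 R, χ x
      ≤ ∫ x in Set.Ioc 0 R, Real.exp 1 * (Real.exp (-R⁻¹ * x) * χ x) :=
        setIntegral_mono_on (integrableOn_Ioc_of_mem_Icc hχ h0 h1 0 R)
          (IntegrableOn.mono_set hint Set.Ioc_subset_Ioi_self) measurableSet_Ioc hle
    _ ≤ _ := setIntegral_mono_set hint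
        (.of_forall fun x => by have := h0 x; positivity) Set.Ioc_subset_Ioi_self.eventuallyLE

theorem integrableOn_Ioi_of_mul_le_convolution (hχ : Measurable χ) (h0 : ∀ x, 0 ≤ χ x)
    (h1 : ∀ x, χ x ≤ 1) (hne : ¬ χ =ᵐ[volume.restrict (Set.Ioi 0)] 1)
    (hconv : ∀ r, 0 < r → r * χ r ≤ ∫ s in (0 : ℝ)..r, χ s * χ (r - s)) :
    IntegrableOn χ (Set.Ioi 0) := by
  obtain ⟨C, hC⟩ := exists_laplace_le hχ h0 h1 hne hconv
  refine integrableOn_Ioi_of_intervalIntegral_norm_bounded (Real.exp 1 * C) 0 (fun R => ?_)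
    tendsto_id ?_
  · exact integrableOn_Ioc_of_mem_Icc hχ h0 h1 0 R
  · filter_upwards [eventually_ge_atTop 1] with R hR
    have hR0 : 0 < R := one_pos.trans_le hR
    simp only [Real.norm_of_nonneg (h0 _), id]
    exact (intervalIntegral_le_exp_one_mul_laplace hχ h0 h1 hR0).trans
      (mul_le_mul_of_nonneg_left (hC _ ⟨inv_pos.2 hR0, inv_le_one_of_one_le₀ hR⟩)
        (Real.exp_pos 1).le)

end Laplace

section Growth

/-- The factor `∏_{j < n} (1 + σ / (p + j)) = Γ(p) Γ(p + σ + n) / (Γ(p + σ) Γ(p + n))` by which the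
mean of `u₂` is multiplied in `n` drawings from an urn of mass `p`. -/
noncomputable def growth (σ p : ℝ) (n : ℕ) : ℝ := ∏ j ∈ Finset.range n, (1 + σ / (p + j))

/-- The limit of `growth σ p n / n ^ σ`. -/
noncomputable def growthConst (σ p : ℝ) : ℝ := Real.Gamma p / Real.Gamma (p + σ)

/-- The remainder `∑_{k > n} 1 / growth σ p k ^ 2`, which controls how far the rescaled process
still moves after time `n`. -/
noncomputable def growthTail (σ p : ℝ) (n : ℕ) : ℝ := ∑' k, 1 / growth σ p (k + (n + 1)) ^ 2

@[simp]
theorem growth_zero (σ p : ℝ) : growth σ p 0 = 1 := by simp [growth]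

theorem growth_succ (σ p : ℝ) (n : ℕ) :
    growth σ p (n + 1) = growth σ p n * (1 + σ / (p + n)) :=
  Finset.prod_range_succ ..

theorem tendsto_growthTail (σ p : ℝ) : Tendsto (growthTail σ p) atTop (𝓝 0) :=
  (tendsto_sum_nat_add fun n => 1 / growth σ p n ^ 2).comp (tendsto_add_atTop_nat 1)

theorem growthTail_nonneg (σ p : ℝ) (n : ℕ) : 0 ≤ growthTail σ p n :=
  tsum_nonneg fun _ => by positivity

variable {σ p : ℝ}

theorem one_le_one_add_div (hσ : 0 ≤ σ) (hp : 0 < p) (n : ℕ) : 1 ≤ 1 + σ / (p + n) :=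
  le_add_of_nonneg_right (by positivity)

theorem one_le_growth (hσ : 0 ≤ σ) (hp : 0 < p) (n : ℕ) : 1 ≤ growth σ p n :=
  Finset.prod_induction _ (fun x : ℝ => 1 ≤ x) (fun _ _ => one_le_mul_of_one_le_of_one_le) le_rfl
    fun j _ => one_le_one_add_div hσ hp j

theorem growth_pos (hσ : 0 ≤ σ) (hp : 0 < p) (n : ℕ) : 0 < growth σ p n :=
  zero_lt_one.trans_le (one_le_growth hσ hp n)

theorem one_div_growth_succ_mul (hσ : 0 ≤ σ) (hp : 0 < p) (n : ℕ) :
    1 / growth σ p (n + 1) * (1 + σ / (p + n)) = 1 / growth σ p n := by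
  have := (zero_lt_one.trans_le (one_le_one_add_div hσ hp n)).ne'
  rw [growth_succ, one_div_mul_eq_div, div_mul_cancel_right₀ this, one_div]

theorem growthConst_pos (hσ : 0 ≤ σ) (hp : 0 < p) : 0 < growthConst σ p :=
  div_pos (Real.Gamma_pos_of_pos hp) (Real.Gamma_pos_of_pos (by positivity))

theorem growth_eq_prod_div_prod (hp : 0 < p) (n : ℕ) :
    growth σ p n = (∏ j ∈ Finset.range n, (p + σ + j)) / ∏ j ∈ Finset.range n, (p + j) := by
  rw [growth, ← Finset.prod_div_distrib]
  refine Finset.prod_congr rfl fun j _ => ?_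
  have : 0 < p + j := by positivity
  field_simp
  ring

theorem tendsto_growth_succ_div (hσ : 0 ≤ σ) (hp : 0 < p) :
    Tendsto (fun n : ℕ => growth σ p (n + 1) / (n : ℝ) ^ σ) atTop (𝓝 (growthConst σ p)) := by
  refine ((Real.GammaSeq_tendsto_Gamma p).div (Real.GammaSeq_tendsto_Gamma (p + σ))
    (Real.Gamma_pos_of_pos (by positivity)).ne').congr' ?_
  filter_upwards [eventually_gt_atTop 0] with n hn
  have hn' : (0 : ℝ) < n := by exact_mod_cast hn
  have hnum : ∏ j ∈ Finset.range (n + 1), (p + σ + j) ≠ 0 :=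
    (Finset.prod_pos fun j _ => by positivity).ne'
  have hden : ∏ j ∈ Finset.range (n + 1), (p + j) ≠ 0 :=
    (Finset.prod_pos fun j _ => by positivity).ne'
  rw [Pi.div_apply, Real.GammaSeq, Real.GammaSeq, growth_eq_prod_div_prod hp, Real.rpow_add hn']
  field_simp [hnum, hden]

theorem tendsto_growth_div (hσ : 0 ≤ σ) (hp : 0 < p) :
    Tendsto (fun n : ℕ => growth σ p n / (n : ℝ) ^ σ) atTop (𝓝 (growthConst σ p)) := by
  have hfactor : Tendsto (fun n : ℕ => 1 + σ / (p + n)) atTop (𝓝 1) := by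
    simpa using tendsto_const_nhds.add ((tendsto_const_nhds (x := σ)).div_atTop
      (tendsto_atTop_add_const_left _ p tendsto_natCast_atTop_atTop))
  have := (tendsto_growth_succ_div hσ hp).div hfactor one_ne_zero
  rw [div_one] at this
  refine this.congr fun n => ?_
  have := (zero_lt_one.trans_le (one_le_one_add_div hσ hp n)).ne'
  rw [Pi.div_apply, growth_succ, div_right_comm, mul_div_cancel_right₀ _ this]

theorem tendsto_mul_growth (hσ : 0 ≤ σ) (hp : 0 < p) {ι : Type*} {l : Filter ι} {k : ι → ℕ}
    {θ : ι → ℝ} {t : ℝ} (hk : Tendsto k l atTop)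
    (hθ : Tendsto (fun i => θ i * (k i : ℝ) ^ σ) l (𝓝 t)) :
    Tendsto (fun i => θ i * growth σ p (k i)) l (𝓝 (growthConst σ p * t)) := by
  refine (((tendsto_growth_div hσ hp).comp hk).mul hθ).congr' ?_
  filter_upwards [hk.eventually_gt_atTop 0] with i hi
  have : (0 : ℝ) < k i := by exact_mod_cast hi
  simp only [Function.comp]
  field_simp

theorem summable_one_div_growth_sq (hσ : 1 / 2 < σ) (hp : 0 < p) :
    Summable fun n => 1 / growth σ p n ^ 2 := by
  have hσ0 : 0 ≤ σ := by linarith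
  have hlim := ((tendsto_growth_div hσ0 hp).inv₀ (growthConst_pos hσ0 hp).ne').pow 2
  refine summable_of_isBigO_nat (Real.summable_nat_rpow.2 (show -(2 * σ) < -1 by linarith)) ?_
  refine (Asymptotics.isBigO_of_div_tendsto_nhds ?_ _ (hlim.congr' ?_))
  · filter_upwards [eventually_gt_atTop 0] with n hn h
    exact absurd h (Real.rpow_pos_of_pos (by exact_mod_cast hn) _).ne'
  · filter_upwards [eventually_gt_atTop 0] with n hn
    have hn' : (0 : ℝ) < n := by exact_mod_cast hn
    have := growth_pos hσ0 hp n
    rw [Pi.div_apply, Real.rpow_neg hn'.le, mul_comm, Real.rpow_mul hn'.le, Real.rpow_two]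
    field_simp

theorem summable_one_div_growth_add_sq (hσ : 1 / 2 < σ) (hp : 0 < p) (n : ℕ) :
    Summable fun k => 1 / growth σ p (k + n) ^ 2 :=
  (summable_nat_add_iff n).2 (summable_one_div_growth_sq hσ hp)

theorem sum_one_div_growth_sq_le_growthTail (hσ : 1 / 2 < σ) (hp : 0 < p) (n k : ℕ) :
    ∑ j ∈ Finset.range k, 1 / growth σ p (j + (n + 1)) ^ 2 ≤ growthTail σ p n :=
  (summable_one_div_growth_add_sq hσ hp (n + 1)).sum_le_tsum _ fun _ _ => by positivity

theorem tendsto_growth_atTop (hσ : 0 < σ) (hp : 0 < p) : Tendsto (growth σ p) atTop atTop := by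
  have hpow : Tendsto (fun n : ℕ => (n : ℝ) ^ σ) atTop atTop :=
    (tendsto_rpow_atTop hσ).comp tendsto_natCast_atTop_atTop
  refine ((tendsto_growth_div hσ.le hp).pos_mul_atTop (growthConst_pos hσ.le hp) hpow).congr' ?_
  filter_upwards [eventually_gt_atTop 0] with n hn
  exact div_mul_cancel₀ _ (Real.rpow_pos_of_pos (by exact_mod_cast hn) _).ne'

theorem tendsto_growth_succ_div_self (hσ : 0 ≤ σ) (hσ1 : σ < 1) (hp : 0 < p) :
    Tendsto (fun n : ℕ => growth σ p (n + 1) / n) atTop (𝓝 0) := by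
  have hpow : Tendsto (fun n : ℕ => (n : ℝ) ^ (-(1 - σ))) atTop (𝓝 0) :=
    (tendsto_rpow_neg_atTop (sub_pos.2 hσ1)).comp tendsto_natCast_atTop_atTop
  have := (tendsto_growth_succ_div hσ hp).mul hpow
  rw [mul_zero] at this
  refine this.congr' ?_
  filter_upwards [eventually_gt_atTop 0] with n hn
  have hn' : (0 : ℝ) < n := by exact_mod_cast hn
  have := Real.rpow_pos_of_pos hn' σ
  rw [neg_sub, Real.rpow_sub hn', Real.rpow_one]
  field_simp

end Growth

section Urn

/-- The replacement matrix with rows `(a, b)`, `(c, d)` is balanced, non-triangular and large. -/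
structure IsLarge (a b c d : ℕ) : Prop where
  balanced : a + b = c + d
  b_ne_zero : b ≠ 0
  c_ne_zero : c ≠ 0
  half_lt_ratio : 1 / 2 < ratio a b c

/-- The number of balls of an urn in units of the balance `S = a + b`: every drawing increases it
by one. -/
noncomputable def mass (a b : ℕ) (u : ℕ × ℕ) : ℝ := ((u.1 : ℝ) + u.2) / ((a : ℝ) + b)

/-- The probability of drawing a red ball. -/
noncomputable def probRed (u : ℕ × ℕ) : ℝ := (u.1 : ℝ) / ((u.1 : ℝ) + u.2)

/-- The probability of drawing a black ball. -/
noncomputable def probBlack (u : ℕ × ℕ) : ℝ := (u.2 : ℝ) / ((u.1 : ℝ) + u.2)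

/-- The difference between the two possible increments of `u₂` in a drawing. -/
noncomputable def jump (a b c : ℕ) : ℝ := ratio a b c * ((b : ℝ) + c)

theorem probRed_nonneg (u : ℕ × ℕ) : 0 ≤ probRed u := by unfold probRed; positivity

theorem probBlack_nonneg (u : ℕ × ℕ) : 0 ≤ probBlack u := by unfold probBlack; positivity

theorem probRed_pos {u : ℕ × ℕ} (hu : 0 < u.1) : 0 < probRed u := by unfold probRed; positivity

theorem probBlack_pos {u : ℕ × ℕ} (hu : 0 < u.2) : 0 < probBlack u := by
  unfold probBlack; positivity

section Mass

variable {a b c d : ℕ} {u : ℕ × ℕ}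

theorem balance_pos (hu : 0 < mass a b u) : (0 : ℝ) < (a : ℝ) + b := by
  refine lt_of_le_of_ne (by positivity) fun h0 => ?_
  rw [mass, ← h0, div_zero] at hu
  exact hu.false

theorem total_pos (hu : 0 < mass a b u) : (0 : ℝ) < (u.1 : ℝ) + u.2 :=
  (div_pos_iff_of_pos_right (balance_pos hu)).1 hu

theorem probRed_add_probBlack (hu : 0 < mass a b u) : probRed u + probBlack u = 1 := by
  rw [probRed, probBlack, ← add_div, div_self (total_pos hu).ne']

theorem mass_add (v w : ℕ × ℕ) : mass a b (v + w) = mass a b v + mass a b w := by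
  simp only [mass, Prod.fst_add, Prod.snd_add, Nat.cast_add]
  ring

theorem mass_add_red (hu : 0 < mass a b u) : mass a b (u + (a, b)) = mass a b u + 1 := by
  rw [mass_add, mass, mass, div_self (balance_pos hu).ne']

theorem mass_add_black (hS : a + b = c + d) (hu : 0 < mass a b u) :
    mass a b (u + (c, d)) = mass a b u + 1 := by
  have hS' : (c : ℝ) + d = a + b := by exact_mod_cast hS.symm
  rw [mass_add, mass, mass, hS', div_self (balance_pos hu).ne']

theorem mass_add_red_pos (hu : 0 < mass a b u) : 0 < mass a b (u + (a, b)) := by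
  rw [mass_add_red hu]; positivity

theorem mass_add_black_pos (hS : a + b = c + d) (hu : 0 < mass a b u) :
    0 < mass a b (u + (c, d)) := by
  rw [mass_add_black hS hu]; positivity

theorem u₂_add (v w : ℕ × ℕ) : u₂ a b c (v + w) = u₂ a b c v + u₂ a b c w := by
  simp only [u₂, Prod.fst_add, Prod.snd_add, Nat.cast_add]
  ring

theorem u₂_red (a b c : ℕ) : u₂ a b c (a, b) = ratio a b c * b := by
  rw [u₂, ratio]
  ring

end Mass

namespace IsLarge

variable {a b c d : ℕ} (h : IsLarge a b c d)
include h

theorem b_pos : 0 < b := Nat.pos_of_ne_zero h.b_ne_zero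

theorem c_pos : 0 < c := Nat.pos_of_ne_zero h.c_ne_zero

theorem ratio_pos : 0 < ratio a b c := one_half_pos.trans h.half_lt_ratio

theorem jump_pos : 0 < jump a b c := by
  have := h.ratio_pos
  have := h.b_pos
  unfold jump
  positivity

theorem ratio_lt_one : ratio a b c < 1 := by
  have := h.b_pos
  rw [ratio, div_lt_one (by positivity)]
  have : (0 : ℝ) < b + c := by positivity
  linarith

theorem c_lt_a : c < a := by
  have := h.ratio_pos
  rw [ratio, div_pos_iff_of_pos_right (by have := h.b_pos; positivity), sub_pos] at this
  exact_mod_cast this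

theorem a_pos : 0 < a := h.c_pos.trans h.c_lt_a

theorem d_pos : 0 < d := by
  have := h.c_lt_a
  have := h.balanced
  omega

theorem mass_pos {u : ℕ × ℕ} (hu : u ≠ 0) : 0 < mass a b u := by
  have hb := h.b_pos
  have : 0 < u.1 + u.2 := by
    by_contra h0
    exact hu (Prod.ext (by simp; omega) (by simp; omega))
  have : (0 : ℝ) < (u.1 : ℝ) + u.2 := by exact_mod_cast this
  unfold mass
  positivity

theorem u₂_black : u₂ a b c (c, d) = -(ratio a b c * c) := by
  have hd : (d : ℝ) = a + b - c := by rw [eq_sub_iff_add_eq']; exact_mod_cast h.balanced.symm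
  rw [u₂, ratio, hd]
  ring

theorem u₂_red_sub_u₂_black : u₂ a b c (a, b) - u₂ a b c (c, d) = jump a b c := by
  rw [u₂_red, h.u₂_black, jump]
  ring

theorem mean_increment {u : ℕ × ℕ} (hu : 0 < mass a b u) :
    probRed u * u₂ a b c (a, b) + probBlack u * u₂ a b c (c, d) =
      ratio a b c / mass a b u * u₂ a b c u := by
  have := total_pos hu
  have := balance_pos hu
  rw [u₂_red, h.u₂_black, probRed, probBlack, mass, u₂]
  field_simp
  ring

end IsLarge

end Urn

section TransitionOperator

/-- The transition operator of the urn, acting on vector-valued functions of the composition: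
`transitionOp f u` is the mean of `f` after one drawing from `u`. -/
noncomputable def transitionOp (a b c d : ℕ) (E : Type*) [AddCommGroup E] [Module ℝ E] :
    Module.End ℝ (ℕ × ℕ → E) where
  toFun f u := probRed u • f (u + (a, b)) + probBlack u • f (u + (c, d))
  map_add' f g := by
    ext u
    simp only [Pi.add_apply, smul_add]
    abel
  map_smul' r f := by
    ext u
    simp only [Pi.smul_apply, RingHom.id_apply, smul_add, smul_comm r]

variable {a b c d : ℕ} {E : Type*} [AddCommGroup E] [Module ℝ E]

theorem transitionOp_apply (f : ℕ × ℕ → E) (u : ℕ × ℕ) :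
    transitionOp a b c d E f u = probRed u • f (u + (a, b)) + probBlack u • f (u + (c, d)) := rfl

theorem transitionOp_pow_succ_apply (f : ℕ × ℕ → E) (n : ℕ) (u : ℕ × ℕ) :
    (transitionOp a b c d E ^ (n + 1)) f u =
      probRed u • (transitionOp a b c d E ^ n) f (u + (a, b)) +
        probBlack u • (transitionOp a b c d E ^ n) f (u + (c, d)) := by
  rw [pow_succ', Module.End.mul_apply, transitionOp_apply]

theorem transitionOp_pow_succ_apply' (f : ℕ × ℕ → E) (n : ℕ) :
    (transitionOp a b c d E ^ (n + 1)) f =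
      (transitionOp a b c d E ^ n) (transitionOp a b c d E f) := by
  rw [pow_succ, Module.End.mul_apply]

theorem transitionOp_pow_mem_of_convex (hS : a + b = c + d) {s : Set E} (hs : Convex ℝ s)
    {f : ℕ × ℕ → E} (n : ℕ) {u : ℕ × ℕ} (hu : 0 < mass a b u)
    (hf : ∀ v, mass a b v = mass a b u + n → f v ∈ s) :
    (transitionOp a b c d E ^ n) f u ∈ s := by
  induction n generalizing u with
  | zero => exact hf u (by simp)
  | succ n ih =>
    rw [transitionOp_pow_succ_apply]
    refine hs (ih (mass_add_red_pos hu) fun v hv => hf v ?_)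
      (ih (mass_add_black_pos hS hu) fun v hv => hf v ?_)
      (probRed_nonneg u) (probBlack_nonneg u) (probRed_add_probBlack hu)
    · rw [hv, mass_add_red hu]; push_cast; ring
    · rw [hv, mass_add_black hS hu]; push_cast; ring

theorem norm_transitionOp_pow_le {E : Type*} [NormedAddCommGroup E] [NormedSpace ℝ E]
    (hS : a + b = c + d) {f : ℕ × ℕ → E} {C : ℝ} (n : ℕ) {u : ℕ × ℕ} (hu : 0 < mass a b u)
    (hf : ∀ v, mass a b v = mass a b u + n → ‖f v‖ ≤ C) :
    ‖(transitionOp a b c d E ^ n) f u‖ ≤ C := by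
  simpa using transitionOp_pow_mem_of_convex hS (convex_closedBall (0 : E) C) n hu
    (by simpa using hf)

theorem transitionOp_pow_le_add (hS : a + b = c + d) {f g : ℕ × ℕ → ℝ} {C : ℝ} (n : ℕ)
    {u : ℕ × ℕ} (hu : 0 < mass a b u)
    (hfg : ∀ v, mass a b v = mass a b u + n → f v ≤ g v + C) :
    (transitionOp a b c d ℝ ^ n) f u ≤ (transitionOp a b c d ℝ ^ n) g u + C := by
  have := transitionOp_pow_mem_of_convex hS (convex_Iic C) (f := f - g) n hu
    fun v hv => sub_le_iff_le_add'.2 (hfg v hv)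
  rwa [map_sub, Pi.sub_apply, Set.mem_Iic, sub_le_iff_le_add'] at this

theorem transitionOp_pow_nonneg {f : ℕ × ℕ → ℝ} (hf : ∀ v, 0 ≤ f v) (n : ℕ) (u : ℕ × ℕ) :
    0 ≤ (transitionOp a b c d ℝ ^ n) f u := by
  induction n generalizing u with
  | zero => exact hf u
  | succ n ih =>
    rw [transitionOp_pow_succ_apply]
    exact add_nonneg (mul_nonneg (probRed_nonneg u) (ih _)) (mul_nonneg (probBlack_nonneg u) (ih _))

end TransitionOperator

section SecondOrder

theorem mul_sq_add_mul_sq_of_mean_zero {p q x y : ℝ} (hpq : p + q = 1) (hmean : p * x + q * y = 0) :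
    p * x ^ 2 + q * y ^ 2 = p * q * (x - y) ^ 2 := by
  obtain rfl : q = 1 - p := by linarith
  linear_combination (p * x + (1 - p) * y) * hmean

theorem norm_exp_mul_I_sub_le (x : ℝ) :
    ‖Complex.exp (x * Complex.I) - 1 - x * Complex.I‖ ≤ 3 * x ^ 2 := by
  have hx : ‖(x : ℂ) * Complex.I‖ = |x| := by simp
  rcases le_or_gt |x| 1 with h | h
  · have := Complex.norm_exp_sub_one_sub_id_le (x := x * Complex.I) (by rwa [hx])
    rw [hx, sq_abs] at this
    nlinarith [sq_nonneg x]
  · calc ‖Complex.exp (x * Complex.I) - 1 - x * Complex.I‖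
        ≤ ‖Complex.exp (x * Complex.I)‖ + ‖(1 : ℂ)‖ + ‖(x : ℂ) * Complex.I‖ :=
          (norm_sub_le _ _).trans (by gcongr; exact norm_sub_le _ _)
      _ = 1 + 1 + |x| := by rw [Complex.norm_exp_ofReal_mul_I, norm_one, hx]
      _ ≤ 3 * x ^ 2 := by nlinarith [sq_abs x]

theorem norm_mul_exp_add_mul_exp_sub_one_le {p q x y : ℝ} (hp : 0 ≤ p) (hq : 0 ≤ q)
    (hpq : p + q = 1) (hmean : p * x + q * y = 0) :
    ‖p * Complex.exp (x * Complex.I) + q * Complex.exp (y * Complex.I) - 1‖ ≤ (x - y) ^ 2 := by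
  have hpqC : (p : ℂ) + q = 1 := by exact_mod_cast hpq
  have hmeanC : (p : ℂ) * x + q * y = 0 := by exact_mod_cast hmean
  have hsplit : p * Complex.exp (x * Complex.I) + q * Complex.exp (y * Complex.I) - 1 =
      p * (Complex.exp (x * Complex.I) - 1 - x * Complex.I) +
        q * (Complex.exp (y * Complex.I) - 1 - y * Complex.I) := by
    linear_combination hpqC + Complex.I * hmeanC
  have hpq4 : 3 * (p * q) ≤ 1 := by nlinarith [sq_nonneg (p - q)]
  calc _ ≤ p * (3 * x ^ 2) + q * (3 * y ^ 2) := by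
        rw [hsplit]
        refine (norm_add_le _ _).trans ?_
        rw [norm_mul, norm_mul, Complex.norm_of_nonneg hp, Complex.norm_of_nonneg hq]
        gcongr <;> exact norm_exp_mul_I_sub_le _
    _ = 3 * (p * q) * (x - y) ^ 2 := by
        linear_combination 3 * mul_sq_add_mul_sq_of_mean_zero hpq hmean
    _ ≤ (x - y) ^ 2 := mul_le_of_le_one_left (sq_nonneg _) hpq4

end SecondOrder

section CharacteristicFunctions

/-- The character `exp (i θ u₂)`. -/
noncomputable def wave (a b c : ℕ) (θ : ℝ) (u : ℕ × ℕ) : ℂ :=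
  Complex.exp ((θ * u₂ a b c u : ℝ) * Complex.I)

/-- The characteristic function at `θ` of `u₂ (U n)` for the urn process started at `u`. -/
noncomputable def charSeq (a b c d n : ℕ) (θ : ℝ) (u : ℕ × ℕ) : ℂ :=
  (transitionOp a b c d ℂ ^ n) (wave a b c θ) u

/-- The limit of the characteristic functions of `u₂ (U n) / growth n` for the urn process started
at `u`. -/
noncomputable def scaledLimitChar (a b c d : ℕ) (u : ℕ × ℕ) (τ : ℝ) : ℂ :=
  limUnder atTop fun n => charSeq a b c d n (τ / growth (ratio a b c) (mass a b u) n) u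

/-- The limit of the characteristic functions of `u₂ (U n) / n ^ σ` for the urn process started
at `u`. -/
noncomputable def limitChar (a b c d : ℕ) (u : ℕ × ℕ) (t : ℝ) : ℂ :=
  scaledLimitChar a b c d u (growthConst (ratio a b c) (mass a b u) * t)

variable {a b c d : ℕ}

theorem norm_wave (θ : ℝ) (u : ℕ × ℕ) : ‖wave a b c θ u‖ = 1 := Complex.norm_exp_ofReal_mul_I _

theorem wave_add (θ : ℝ) (v w : ℕ × ℕ) :
    wave a b c θ (v + w) = wave a b c θ v * wave a b c θ w := by
  rw [wave, wave, wave, u₂_add, mul_add, Complex.ofReal_add, add_mul, Complex.exp_add]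

theorem hasDerivAt_wave_mul_zero (κ : ℝ) (u : ℕ × ℕ) :
    HasDerivAt (fun t => wave a b c (κ * t) u) ((κ * u₂ a b c u : ℝ) * Complex.I) 0 := by
  have hexponent : HasDerivAt (fun t : ℝ => ((κ * t * u₂ a b c u : ℝ) : ℂ) * Complex.I)
      ((κ * u₂ a b c u : ℝ) * Complex.I) 0 := by
    refine (HasDerivAt.ofReal_comp ?_).mul_const _
    simpa using ((hasDerivAt_id (0 : ℝ)).const_mul κ).mul_const (u₂ a b c u)
  simpa [wave] using hexponent.cexp

theorem norm_charSeq_le_one (hS : a + b = c + d) (n : ℕ) (θ : ℝ) {u : ℕ × ℕ}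
    (hu : 0 < mass a b u) : ‖charSeq a b c d n θ u‖ ≤ 1 :=
  norm_transitionOp_pow_le hS n hu fun _ _ => (norm_wave ..).le

theorem charSeq_zero (θ : ℝ) (u : ℕ × ℕ) : charSeq a b c d 0 θ u = wave a b c θ u := rfl

theorem charSeq_succ (n : ℕ) (θ : ℝ) (u : ℕ × ℕ) :
    charSeq a b c d (n + 1) θ u =
      probRed u • charSeq a b c d n θ (u + (a, b)) +
        probBlack u • charSeq a b c d n θ (u + (c, d)) :=
  transitionOp_pow_succ_apply ..

theorem continuous_charSeq (n : ℕ) (u : ℕ × ℕ) : Continuous fun θ => charSeq a b c d n θ u := by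
  induction n generalizing u with
  | zero =>
    simp only [charSeq_zero, wave]
    fun_prop
  | succ n ih =>
    simp only [charSeq_succ]
    exact ((ih _).const_smul (_ : ℝ)).add ((ih _).const_smul (_ : ℝ))

theorem hasDerivAt_zero_of_norm_sub_le_mul_sq {E : Type*} [NormedAddCommGroup E] [NormedSpace ℝ E]
    {f g : ℝ → E} {g' : E} {C : ℝ} (hg : HasDerivAt g g' 0)
    (hfg : ∀ t, ‖f t - g t‖ ≤ C * t ^ 2) : HasDerivAt f g' 0 := by
  have h0 : f 0 - g 0 = 0 := by simpa using hfg 0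
  have hdiff : HasDerivAt (fun t => f t - g t) 0 0 := by
    rw [hasDerivAt_iff_isLittleO_nhds_zero]
    simp only [zero_add, h0, smul_zero, sub_zero]
    have hbig : (fun t => f t - g t) =O[𝓝 0] fun t : ℝ => t ^ 2 :=
      .of_bound C (.of_forall fun t => by simpa using hfg t)
    exact hbig.trans_isLittleO (by simpa using Asymptotics.isLittleO_pow_id (𝕜 := ℝ) one_lt_two)
  simpa using (hdiff.add hg).congr_of_eventuallyEq (f₁ := f) (.of_forall fun t => by simp)

namespace IsLarge

variable (h : IsLarge a b c d)
include h

theorem norm_transitionOp_wave_sub_le (θ : ℝ) {u : ℕ × ℕ} (hu : 0 < mass a b u) :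
    ‖transitionOp a b c d ℂ (wave a b c θ) u -
      wave a b c (θ * (1 + ratio a b c / mass a b u)) u‖ ≤ (jump a b c * θ) ^ 2 := by
  have hpq := probRed_add_probBlack hu
  set z := ratio a b c / mass a b u * u₂ a b c u with hz
  have hmean : probRed u * (θ * (u₂ a b c (a, b) - z)) +
      probBlack u * (θ * (u₂ a b c (c, d) - z)) = 0 := by
    linear_combination θ * h.mean_increment hu - θ * z * hpq
  have hwave : ∀ v, wave a b c θ (u + v) =
      wave a b c (θ * (1 + ratio a b c / mass a b u)) u *
        Complex.exp ((θ * (u₂ a b c v - z) : ℝ) * Complex.I) := fun v => by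
    rw [wave, wave, ← Complex.exp_add, ← add_mul, ← Complex.ofReal_add, u₂_add, hz]
    congr 3
    ring
  have hbound := norm_mul_exp_add_mul_exp_sub_one_le (probRed_nonneg u) (probBlack_nonneg u) hpq
    hmean
  rw [← mul_sub, sub_sub_sub_cancel_right, h.u₂_red_sub_u₂_black, mul_comm θ (jump a b c)] at hbound
  rw [transitionOp_apply, hwave, hwave, Complex.real_smul, Complex.real_smul, mul_left_comm,
    mul_left_comm (probBlack u : ℂ), ← mul_add, ← mul_sub_one, norm_mul, norm_wave, one_mul]
  exact hbound

theorem norm_charSeq_succ_sub_le (n : ℕ) (θ : ℝ) {u : ℕ × ℕ} (hu : 0 < mass a b u) :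
    ‖charSeq a b c d (n + 1) θ u -
      charSeq a b c d n (θ * (1 + ratio a b c / (mass a b u + n))) u‖ ≤ (jump a b c * θ) ^ 2 := by
  rw [charSeq, charSeq, transitionOp_pow_succ_apply', ← Pi.sub_apply, ← map_sub]
  refine norm_transitionOp_pow_le h.balanced n hu fun v hv => ?_
  rw [← hv]
  exact h.norm_transitionOp_wave_sub_le θ (hv ▸ by positivity)

section Limit

variable {u : ℕ × ℕ} (hu : 0 < mass a b u)
include hu

theorem dist_charSeq_div_growth_succ_le (τ : ℝ) (n : ℕ) :
    dist (charSeq a b c d n (τ / growth (ratio a b c) (mass a b u) n) u)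
      (charSeq a b c d (n + 1) (τ / growth (ratio a b c) (mass a b u) (n + 1)) u) ≤
      (jump a b c * τ) ^ 2 * (1 / growth (ratio a b c) (mass a b u) (n + 1) ^ 2) := by
  have hstep := h.norm_charSeq_succ_sub_le n (τ / growth (ratio a b c) (mass a b u) (n + 1)) hu
  have hscale : τ / growth (ratio a b c) (mass a b u) (n + 1) *
      (1 + ratio a b c / (mass a b u + n)) = τ / growth (ratio a b c) (mass a b u) n := by
    rw [div_eq_mul_one_div, mul_assoc, one_div_growth_succ_mul h.ratio_pos.le hu, mul_one_div]
  rw [hscale, norm_sub_rev, ← dist_eq_norm] at hstep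
  exact hstep.trans_eq (by ring)

theorem norm_charSeq_sub_scaledLimitChar_le (θ : ℝ) (n : ℕ) :
    ‖charSeq a b c d n θ u -
      scaledLimitChar a b c d u (θ * growth (ratio a b c) (mass a b u) n)‖ ≤
      (jump a b c * (θ * growth (ratio a b c) (mass a b u) n)) ^ 2 *
        growthTail (ratio a b c) (mass a b u) n := by
  set τ := θ * growth (ratio a b c) (mass a b u) n
  have hdist := h.dist_charSeq_div_growth_succ_le hu τ
  have hsum := (summable_one_div_growth_add_sq h.half_lt_ratio hu 1).mul_left
    ((jump a b c * τ) ^ 2)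
  have hlim := (cauchySeq_of_dist_le_of_summable _ hdist hsum).tendsto_limUnder
  have htail := dist_le_tsum_of_dist_le_of_tendsto _ hdist hsum hlim n
  have hθ : τ / growth (ratio a b c) (mass a b u) n = θ :=
    mul_div_cancel_right₀ _ (growth_pos h.ratio_pos.le hu n).ne'
  rw [dist_eq_norm, hθ, tsum_mul_left] at htail
  simpa only [growthTail, scaledLimitChar, add_left_comm n, add_assoc] using htail

theorem continuous_scaledLimitChar : Continuous (scaledLimitChar a b c d u) := by
  set γ := growth (ratio a b c) (mass a b u)
  have hunif : TendstoLocallyUniformly (fun n τ => charSeq a b c d n (τ / γ n) u)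
      (scaledLimitChar a b c d u) atTop := by
    refine tendstoLocallyUniformly_iff_forall_isCompact.2 fun s hs =>
      Metric.tendstoUniformlyOn_iff.2 fun ε hε => ?_
    obtain ⟨R, hR⟩ := hs.isBounded.exists_norm_le
    have hlim := (tendsto_growthTail (ratio a b c) (mass a b u)).const_mul ((jump a b c * R) ^ 2)
    rw [mul_zero] at hlim
    filter_upwards [hlim.eventually_lt_const hε] with n hn τ hτ
    have hbound := h.norm_charSeq_sub_scaledLimitChar_le hu (τ / γ n) n
    rw [div_mul_cancel₀ _ (growth_pos h.ratio_pos.le hu n).ne'] at hbound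
    rw [dist_comm, dist_eq_norm]
    refine (hbound.trans ?_).trans_lt hn
    rw [mul_pow, mul_pow]
    exact mul_le_mul_of_nonneg_right (mul_le_mul_of_nonneg_left
      (sq_le_sq.2 ((hR τ hτ).trans (le_abs_self R))) (sq_nonneg _)) (growthTail_nonneg ..)
  exact hunif.continuous (.of_forall fun n =>
    (continuous_charSeq n u).comp (continuous_id.div_const _))

theorem continuous_limitChar : Continuous (limitChar a b c d u) :=
  (h.continuous_scaledLimitChar hu).comp (continuous_const_mul _)

theorem tendsto_charSeq {ι : Type*} {l : Filter ι} {k : ι → ℕ} {θ : ι → ℝ} {t : ℝ}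
    (hk : Tendsto k l atTop) (hθ : Tendsto (fun i => θ i * (k i : ℝ) ^ ratio a b c) l (𝓝 t)) :
    Tendsto (fun i => charSeq a b c d (k i) (θ i) u) l (𝓝 (limitChar a b c d u t)) := by
  have hgrowth := tendsto_mul_growth h.ratio_pos.le hu hk hθ
  have hchar := ((h.continuous_scaledLimitChar hu).tendsto _).comp hgrowth
  have herror := ((hgrowth.const_mul (jump a b c)).pow 2).mul
    ((tendsto_growthTail (ratio a b c) (mass a b u)).comp hk)
  rw [mul_zero] at herror
  have hdiff := squeeze_zero_norm
    (fun i => h.norm_charSeq_sub_scaledLimitChar_le hu (θ i) (k i)) herror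
  simpa [Function.comp_def, limitChar] using hdiff.add hchar

theorem tendsto_charSeq_div_rpow (t : ℝ) :
    Tendsto (fun n : ℕ => charSeq a b c d n (t / (n : ℝ) ^ ratio a b c) u) atTop
      (𝓝 (limitChar a b c d u t)) := by
  refine h.tendsto_charSeq hu tendsto_id (tendsto_const_nhds.congr' ?_)
  filter_upwards [eventually_gt_atTop 0] with n hn
  exact (div_mul_cancel₀ _ (Real.rpow_pos_of_pos (by exact_mod_cast hn) _).ne').symm

theorem norm_limitChar_le_one (t : ℝ) : ‖limitChar a b c d u t‖ ≤ 1 :=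
  le_of_tendsto (h.tendsto_charSeq_div_rpow hu t).norm
    (.of_forall fun n => norm_charSeq_le_one h.balanced n _ hu)

theorem limitChar_eq_one_step (t : ℝ) :
    limitChar a b c d u t = probRed u • limitChar a b c d (u + (a, b)) t +
      probBlack u • limitChar a b c d (u + (c, d)) t := by
  have hratio : Tendsto (fun n : ℕ => t / (n : ℝ) ^ ratio a b c * ((n + 1 : ℕ) : ℝ) ^ ratio a b c)
      atTop (𝓝 t) := by
    have := (((tendsto_natCast_div_add_atTop (1 : ℝ)).inv₀ one_ne_zero).rpow_const
      (p := ratio a b c) (.inl (inv_ne_zero one_ne_zero))).const_mul t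
    rw [inv_one, Real.one_rpow, mul_one] at this
    refine this.congr fun n => ?_
    rw [inv_div, Real.div_rpow (by positivity) (by positivity), Nat.cast_add_one]
    ring
  refine tendsto_nhds_unique (h.tendsto_charSeq hu (tendsto_add_atTop_nat 1) hratio) ?_
  simp only [charSeq_succ]
  exact ((h.tendsto_charSeq_div_rpow (mass_add_red_pos hu) t).const_smul _).add
    ((h.tendsto_charSeq_div_rpow (mass_add_black_pos h.balanced hu) t).const_smul _)

theorem hasDerivAt_limitChar_zero :
    HasDerivAt (limitChar a b c d u)
      ((growthConst (ratio a b c) (mass a b u) * u₂ a b c u : ℝ) * Complex.I) 0 := by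
  refine hasDerivAt_zero_of_norm_sub_le_mul_sq (hasDerivAt_wave_mul_zero _ u)
    (C := (jump a b c * growthConst (ratio a b c) (mass a b u)) ^ 2 *
      growthTail (ratio a b c) (mass a b u) 0) fun t => ?_
  have := h.norm_charSeq_sub_scaledLimitChar_le hu
    (growthConst (ratio a b c) (mass a b u) * t) 0
  rw [growth_zero, mul_one, norm_sub_rev] at this
  exact this.trans_eq (by ring)

theorem eventually_limitChar_add_red_ne_limitChar_add_black :
    ∀ᶠ t in 𝓝[≠] 0, limitChar a b c d (u + (a, b)) t ≠ limitChar a b c d (u + (c, d)) t := by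
  have hderiv := (h.hasDerivAt_limitChar_zero (mass_add_red_pos hu)).sub
    (h.hasDerivAt_limitChar_zero (mass_add_black_pos h.balanced hu))
  rw [mass_add_red hu, mass_add_black h.balanced hu, ← sub_mul, ← Complex.ofReal_sub, ← mul_sub,
    u₂_add, u₂_add, add_sub_add_left_eq_sub, h.u₂_red_sub_u₂_black] at hderiv
  have hκ := growthConst_pos h.ratio_pos.le (add_pos hu one_pos)
  filter_upwards [hderiv.eventually_ne (c := 0) (mul_ne_zero
    (Complex.ofReal_ne_zero.2 (mul_pos hκ h.jump_pos).ne') Complex.I_ne_zero)] with t ht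
  exact sub_ne_zero.1 ht

end Limit

theorem eventually_norm_limitChar_lt_one_of_pos {u : ℕ × ℕ} (hred : 0 < u.1) (hblack : 0 < u.2) :
    ∀ᶠ t in 𝓝[≠] 0, ‖limitChar a b c d u t‖ < 1 := by
  have hu := h.mass_pos (u := u) (by rintro rfl; exact hred.false)
  filter_upwards [h.eventually_limitChar_add_red_ne_limitChar_add_black hu] with t ht
  rw [h.limitChar_eq_one_step hu t]
  exact norm_combo_lt_of_ne (h.norm_limitChar_le_one (mass_add_red_pos hu) t)
    (h.norm_limitChar_le_one (mass_add_black_pos h.balanced hu) t) ht (probRed_pos hred)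
    (probBlack_pos hblack) (probRed_add_probBlack hu)

theorem eventually_norm_limitChar_lt_one {u : ℕ × ℕ} (hu : 0 < mass a b u) :
    ∀ᶠ t in 𝓝[≠] 0, ‖limitChar a b c d u t‖ < 1 := by
  filter_upwards [h.eventually_norm_limitChar_lt_one_of_pos (u := u + (a, b))
      (Nat.add_pos_right _ h.a_pos) (Nat.add_pos_right _ h.b_pos),
    h.eventually_norm_limitChar_lt_one_of_pos (u := u + (c, d))
      (Nat.add_pos_right _ h.c_pos) (Nat.add_pos_right _ h.d_pos)] with t hred hblack
  rw [h.limitChar_eq_one_step hu t, ← mem_ball_zero_iff]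
  exact convex_ball (0 : ℂ) 1 (mem_ball_zero_iff.2 hred) (mem_ball_zero_iff.2 hblack)
    (probRed_nonneg u) (probBlack_nonneg u) (probRed_add_probBlack hu)

end IsLarge

end CharacteristicFunctions

section RisingRatio

/-- The normalized rising factorial `p (p + 1) ⋯ (p + k - 1) / k!`, the coefficient of `x ^ k` in
the binomial series of `(1 - x) ^ (-p)`. -/
noncomputable def risingRatio (p : ℝ) (k : ℕ) : ℝ := ∏ i ∈ Finset.range k, (p + i) / (i + 1)

theorem risingRatio_zero (p : ℝ) : risingRatio p 0 = 1 := Finset.prod_range_zero _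

theorem risingRatio_succ (p : ℝ) (k : ℕ) :
    risingRatio p (k + 1) = risingRatio p k * ((p + k) / (k + 1)) := Finset.prod_range_succ ..

theorem risingRatio_succ_mul (p : ℝ) (k : ℕ) :
    risingRatio p (k + 1) * (k + 1) = p * risingRatio (p + 1) k := by
  induction k with
  | zero => simp [risingRatio]
  | succ k ih =>
    rw [risingRatio_succ, risingRatio_succ (p + 1), ← mul_assoc, ← ih]
    push_cast
    field_simp
    ring

theorem risingRatio_add_one_mul (p : ℝ) (k : ℕ) :
    risingRatio (p + 1) k * p = risingRatio p k * (p + k) := by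
  rw [mul_comm, ← risingRatio_succ_mul, risingRatio_succ]
  field_simp

theorem risingRatio_one (k : ℕ) : risingRatio 1 k = 1 :=
  Finset.prod_eq_one fun i _ => by rw [add_comm, div_self (by positivity)]

theorem risingRatio_pos {p : ℝ} (hp : 0 < p) (k : ℕ) : 0 < risingRatio p k :=
  Finset.prod_pos fun i _ => by positivity

theorem monotone_risingRatio {p : ℝ} (hp : 1 ≤ p) : Monotone (risingRatio p) := by
  refine monotone_nat_of_le_succ fun k => ?_
  rw [risingRatio_succ]
  refine le_mul_of_one_le_right (risingRatio_pos (one_pos.trans_le hp) k).le ?_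
  rw [one_le_div (by positivity)]
  linarith

end RisingRatio

section CharSeries

/-- The generating series of the characteristic functions `charSeq a b c d k θ u`, with weights
making it multiplicative in the initial composition `u`. -/
noncomputable def charSeries (a b c d : ℕ) (θ : ℝ) (u : ℕ × ℕ) : PowerSeries ℂ :=
  PowerSeries.mk fun k => (risingRatio (mass a b u) k : ℂ) * charSeq a b c d k θ u

variable {a b c d : ℕ}

theorem coeff_charSeries (k : ℕ) (θ : ℝ) (u : ℕ × ℕ) :
    (charSeries a b c d θ u).coeff k = risingRatio (mass a b u) k * charSeq a b c d k θ u :=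
  PowerSeries.coeff_mk ..

theorem mass_mul_probRed {u : ℕ × ℕ} (hu : 0 < mass a b u) :
    mass a b u * probRed u = u.1 / ((a : ℝ) + b) := by
  have := total_pos hu
  rw [mass, probRed]
  field_simp

theorem mass_mul_probBlack {u : ℕ × ℕ} (hu : 0 < mass a b u) :
    mass a b u * probBlack u = u.2 / ((a : ℝ) + b) := by
  have := total_pos hu
  rw [mass, probBlack]
  field_simp

theorem derivative_charSeries (hS : a + b = c + d) (θ : ℝ) {u : ℕ × ℕ} (hu : 0 < mass a b u) :
    PowerSeries.derivative ℂ (charSeries a b c d θ u) =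
      ((u.1 / ((a : ℝ) + b) : ℝ) : ℂ) • charSeries a b c d θ (u + (a, b)) +
      ((u.2 / ((a : ℝ) + b) : ℝ) : ℂ) • charSeries a b c d θ (u + (c, d)) := by
  ext n
  have hrising : (risingRatio (mass a b u) (n + 1) : ℂ) * (n + 1) =
      mass a b u * risingRatio (mass a b u + 1) n := by
    exact_mod_cast risingRatio_succ_mul (mass a b u) n
  rw [PowerSeries.coeff_derivative, coeff_charSeries, map_add, map_smul, map_smul,
    coeff_charSeries, coeff_charSeries, mass_add_red hu, mass_add_black hS hu, mul_right_comm,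
    hrising, charSeq_succ, ← mass_mul_probRed hu, ← mass_mul_probBlack hu]
  simp only [Complex.real_smul, smul_eq_mul, Complex.ofReal_mul]
  ring

theorem charSeries_add (hS : a + b = c + d) (θ : ℝ) {v w : ℕ × ℕ} (hv : 0 < mass a b v)
    (hw : 0 < mass a b w) :
    charSeries a b c d θ (v + w) = charSeries a b c d θ v * charSeries a b c d θ w := by
  ext n
  induction n generalizing v w with
  | zero => simp [PowerSeries.coeff_mul, coeff_charSeries, risingRatio_zero, charSeq_zero, wave_add]
  | succ n ih =>
    have hvw : 0 < mass a b (v + w) := by rw [mass_add]; positivity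
    refine mul_right_cancel₀ (b := (n : ℂ) + 1) (by exact_mod_cast n.succ_ne_zero) ?_
    rw [← PowerSeries.coeff_derivative, ← PowerSeries.coeff_derivative, Derivation.leibniz,
      derivative_charSeries hS θ hvw, derivative_charSeries hS θ hv, derivative_charSeries hS θ hw]
    simp only [smul_eq_mul, mul_add, mul_smul_comm, map_add, map_smul,
      ← ih hv (mass_add_red_pos hw), ← ih hv (mass_add_black_pos hS hw),
      ← ih hw (mass_add_red_pos hv), ← ih hw (mass_add_black_pos hS hv)]
    rw [← add_assoc v w (a, b), ← add_assoc v w (c, d), ← add_assoc w v (a, b),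
      ← add_assoc w v (c, d), add_comm w v]
    simp only [Prod.fst_add, Prod.snd_add, Nat.cast_add, add_div, Complex.ofReal_add]
    ring

theorem risingRatio_mul_norm_charSeq_add_le (hS : a + b = c + d) (n : ℕ) (θ : ℝ) {v w : ℕ × ℕ}
    (hv : 0 < mass a b v) (hw : 0 < mass a b w) :
    risingRatio (mass a b v + mass a b w) n * ‖charSeq a b c d n θ (v + w)‖ ≤
      ∑ k ∈ Finset.range (n + 1), risingRatio (mass a b v) k * ‖charSeq a b c d k θ v‖ *
        (risingRatio (mass a b w) (n - k) * ‖charSeq a b c d (n - k) θ w‖) := by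
  have hnorm : ∀ {u : ℕ × ℕ}, 0 < mass a b u → ∀ k, ‖(charSeries a b c d θ u).coeff k‖ =
      risingRatio (mass a b u) k * ‖charSeq a b c d k θ u‖ := fun hu k => by
    rw [coeff_charSeries, norm_mul, Complex.norm_of_nonneg (risingRatio_pos hu k).le]
  have hvw : 0 < mass a b (v + w) := by rw [mass_add]; positivity
  rw [← mass_add, ← hnorm hvw, charSeries_add hS θ hv hw, PowerSeries.coeff_mul,
    Finset.Nat.sum_antidiagonal_eq_sum_range_succ_mk]
  simp only [← hnorm hv, ← hnorm hw, ← norm_mul]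
  exact norm_sum_le _ _

theorem norm_charSeq_add_le (hS : a + b = c + d) (n : ℕ) (θ : ℝ) {v w : ℕ × ℕ}
    (hv : 1 ≤ mass a b v) (hw : mass a b w = 1) :
    ‖charSeq a b c d n θ (v + w)‖ ≤
      mass a b v * (1 / ((n + 1 : ℕ) : ℝ) * ∑ k ∈ Finset.range (n + 1),
        ‖charSeq a b c d k θ v‖ * ‖charSeq a b c d (n - k) θ w‖) := by
  have hv0 : 0 < mass a b v := one_pos.trans_le hv
  have hadd := risingRatio_mul_norm_charSeq_add_le hS n θ hv0 (hw.symm ▸ one_pos)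
  simp only [hw, risingRatio_one, one_mul] at hadd
  set p := mass a b v
  set φ := ‖charSeq a b c d n θ (v + w)‖
  set T := ∑ k ∈ Finset.range (n + 1), ‖charSeq a b c d k θ v‖ * ‖charSeq a b c d (n - k) θ w‖
  have hmono : risingRatio (p + 1) n * φ ≤ risingRatio p n * T := by
    refine hadd.trans ?_
    rw [Finset.mul_sum]
    refine Finset.sum_le_sum fun k hk => ?_
    rw [mul_assoc]
    gcongr
    exact monotone_risingRatio hv (Finset.mem_range_succ_iff.1 hk)
  have hsum : (p + n) * φ ≤ p * T := by
    refine le_of_mul_le_mul_left ?_ (risingRatio_pos hv0 n)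
    calc risingRatio p n * ((p + n) * φ) = p * (risingRatio (p + 1) n * φ) := by
          linear_combination (-φ) * risingRatio_add_one_mul p n
      _ ≤ p * (risingRatio p n * T) := by gcongr
      _ = risingRatio p n * (p * T) := by ring
  rw [one_div_mul_eq_div, ← mul_div_assoc, le_div_iff₀ (by positivity), mul_comm]
  refine le_trans ?_ hsum
  gcongr ?_ * _
  push_cast
  linarith

end CharSeries

section RiemannSums

theorem integral_comp_floor (F : ℕ → ℝ) (N : ℕ) :
    ∫ x in (0 : ℝ)..N, F ⌊x⌋₊ = ∑ k ∈ Finset.range N, F k := by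
  have hcongr : ∀ k : ℕ, ∀ x ∈ Set.Ioo (k : ℝ) ((k + 1 : ℕ) : ℝ), F k = F ⌊x⌋₊ := by
    intro k x hx
    rw [(Nat.floor_eq_iff ((Nat.cast_nonneg k).trans hx.1.le)).2
      ⟨hx.1.le, by exact_mod_cast hx.2⟩]
  have hint : ∀ k < N, IntervalIntegrable (fun x : ℝ => F ⌊x⌋₊) volume (k : ℕ) (k + 1 : ℕ) := by
    intro k _
    rw [intervalIntegrable_iff_integrableOn_Ioo_of_le (by simp)]
    exact (integrableOn_const (C := F k) (by simp)).congr_fun (hcongr k) measurableSet_Ioo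
  have hsum := intervalIntegral.sum_integral_adjacent_intervals (a := fun k : ℕ => (k : ℝ)) hint
  rw [Nat.cast_zero] at hsum
  rw [← hsum]
  refine Finset.sum_congr rfl fun k _ => ?_
  rw [intervalIntegral.integral_of_le (by simp), integral_Ioc_eq_integral_Ioo,
    ← setIntegral_congr_fun measurableSet_Ioo (hcongr k)]
  simp

theorem integral_comp_floor_mul (F : ℕ → ℝ) {N : ℕ} (hN : N ≠ 0) :
    ∫ x in (0 : ℝ)..1, F ⌊(N : ℝ) * x⌋₊ = 1 / (N : ℝ) * ∑ k ∈ Finset.range N, F k := by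
  rw [intervalIntegral.integral_comp_mul_left (fun x => F ⌊x⌋₊) (by exact_mod_cast hN), mul_zero,
    mul_one, integral_comp_floor, smul_eq_mul, one_div]

theorem tendsto_average_range {F : ℕ → ℕ → ℝ} {f : ℝ → ℝ} {C : ℝ} (hF : ∀ n k, |F n k| ≤ C)
    (hlim : ∀ s ∈ Set.Ioo (0 : ℝ) 1,
      Tendsto (fun n : ℕ => F n ⌊((n + 1 : ℕ) : ℝ) * s⌋₊) atTop (𝓝 (f s))) :
    Tendsto (fun n : ℕ => 1 / ((n + 1 : ℕ) : ℝ) * ∑ k ∈ Finset.range (n + 1), F n k) atTop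
      (𝓝 (∫ s in (0 : ℝ)..1, f s)) := by
  simp_rw [← integral_comp_floor_mul _ (Nat.succ_ne_zero _)]
  refine intervalIntegral.tendsto_integral_filter_of_dominated_convergence (fun _ => C)
    (.of_forall fun n => ?_) (.of_forall fun n => .of_forall fun s _ => hF n _) (by simp) ?_
  · exact (Measurable.of_discrete.comp
      (Nat.measurable_floor.comp (measurable_const_mul _))).aestronglyMeasurable
  · filter_upwards [Measure.ae_ne volume 1] with s hs1 hs
    rw [Set.uIoc_of_le zero_le_one] at hs
    exact hlim s ⟨hs.1, lt_of_le_of_ne hs.2 hs1⟩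

theorem tendsto_floor_succ_mul_div {s : ℝ} (hs : 0 ≤ s) :
    Tendsto (fun n : ℕ => (⌊((n + 1 : ℕ) : ℝ) * s⌋₊ : ℝ) / n) atTop (𝓝 s) := by
  have hfloor := (tendsto_nat_floor_mul_div_atTop hs).comp
    (tendsto_natCast_atTop_atTop.comp (tendsto_add_atTop_nat 1))
  have hlim := hfloor.div (tendsto_natCast_div_add_atTop (1 : ℝ)) one_ne_zero
  rw [div_one] at hlim
  refine hlim.congr fun n => ?_
  have : ((n : ℝ) + 1) ≠ 0 := by positivity
  simp only [Function.comp, Pi.div_apply, mul_comm s, Nat.cast_add_one]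
  rw [div_div_eq_mul_div, div_mul_cancel₀ _ this]

theorem tendsto_sub_floor_succ_mul_div {s : ℝ} (hs : s ∈ Set.Ioo (0 : ℝ) 1) :
    Tendsto (fun n : ℕ => ((n - ⌊((n + 1 : ℕ) : ℝ) * s⌋₊ : ℕ) : ℝ) / n) atTop (𝓝 (1 - s)) := by
  refine (tendsto_const_nhds.sub (tendsto_floor_succ_mul_div hs.1.le)).congr' ?_
  filter_upwards [eventually_ne_atTop 0] with n hn
  have hle : ⌊((n + 1 : ℕ) : ℝ) * s⌋₊ ≤ n := by
    refine Nat.lt_succ_iff.1 ((Nat.floor_lt (mul_nonneg (by positivity) hs.1.le)).2 ?_)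
    exact mul_lt_of_lt_one_right (by positivity) hs.2
  rw [Nat.cast_sub hle, sub_div, div_self (by exact_mod_cast hn)]

end RiemannSums

section Convolution

variable {a b c d : ℕ}

namespace IsLarge

variable (h : IsLarge a b c d)
include h

theorem tendsto_charSeq_of_tendsto_div {u : ℕ × ℕ} (hu : 0 < mass a b u) (t : ℝ) {k : ℕ → ℕ}
    {s : ℝ} (hs : 0 < s) (hk : Tendsto (fun n : ℕ => (k n : ℝ) / n) atTop (𝓝 s)) :
    Tendsto (fun n : ℕ => charSeq a b c d (k n) (t / (n : ℝ) ^ ratio a b c) u) atTop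
      (𝓝 (limitChar a b c d u (t * s ^ ratio a b c))) := by
  refine h.tendsto_charSeq hu ?_ ?_
  · rw [← tendsto_natCast_atTop_iff (R := ℝ)]
    refine (hk.pos_mul_atTop hs tendsto_natCast_atTop_atTop).congr' ?_
    filter_upwards [eventually_ne_atTop 0] with n hn
    exact div_mul_cancel₀ _ (by exact_mod_cast hn)
  · refine ((hk.rpow_const (.inl hs.ne')).const_mul t).congr fun n => ?_
    rw [Real.div_rpow (by positivity) (by positivity)]
    ring

theorem norm_limitChar_add_le {v w : ℕ × ℕ} (hv : 1 ≤ mass a b v) (hw : mass a b w = 1) (t : ℝ) :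
    ‖limitChar a b c d (v + w) t‖ ≤ mass a b v * ∫ s in (0 : ℝ)..1,
      ‖limitChar a b c d v (t * s ^ ratio a b c)‖ *
        ‖limitChar a b c d w (t * (1 - s) ^ ratio a b c)‖ := by
  have hv0 : 0 < mass a b v := one_pos.trans_le hv
  have hw0 : 0 < mass a b w := hw.symm ▸ one_pos
  have hvw : 0 < mass a b (v + w) := by rw [mass_add]; positivity
  refine le_of_tendsto_of_tendsto' (h.tendsto_charSeq_div_rpow hvw t).norm ?_
    fun n => norm_charSeq_add_le h.balanced n (t / (n : ℝ) ^ ratio a b c) hv hw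
  refine (tendsto_average_range (C := 1) (fun n k => ?_) fun s hs => ?_).const_mul _
  · rw [abs_mul, abs_norm, abs_norm]
    exact mul_le_one₀ (norm_charSeq_le_one h.balanced _ _ hv0) (norm_nonneg _)
      (norm_charSeq_le_one h.balanced _ _ hw0)
  · exact (h.tendsto_charSeq_of_tendsto_div hv0 t hs.1
        (tendsto_floor_succ_mul_div hs.1.le)).norm.mul
      (h.tendsto_charSeq_of_tendsto_div hw0 t (sub_pos.2 hs.2)
        (tendsto_sub_floor_succ_mul_div hs)).norm

end IsLarge

end Convolution

section Decay

open Finset.HasAntidiagonal (antidiagonal mem_antidiagonal)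

/-- The largest modulus at `r ^ σ` of the limit characteristic functions of the urns of mass one. -/
noncomputable def maxChar (a b c d : ℕ) (r : ℝ) : ℝ :=
  (antidiagonal (a + b)).sup' ⟨(a, b), mem_antidiagonal.2 rfl⟩
    fun u => ‖limitChar a b c d u (r ^ ratio a b c)‖

variable {a b c d : ℕ}

theorem maxChar_nonneg (a b c d : ℕ) (r : ℝ) : 0 ≤ maxChar a b c d r :=
  (norm_nonneg _).trans (Finset.le_sup' (fun u => ‖limitChar a b c d u (r ^ ratio a b c)‖)
    (mem_antidiagonal.2 rfl : (a, b) ∈ _))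

theorem mass_eq_one_iff (hS : 0 < a + b) {u : ℕ × ℕ} : mass a b u = 1 ↔ u.1 + u.2 = a + b := by
  have : (a : ℝ) + b ≠ 0 := by exact_mod_cast hS.ne'
  rw [mass, div_eq_one_iff_eq this]
  exact_mod_cast Iff.rfl

namespace IsLarge

variable (h : IsLarge a b c d)
include h

theorem mem_antidiagonal_iff {u : ℕ × ℕ} :
    u ∈ antidiagonal (a + b) ↔ mass a b u = 1 := by
  rw [mem_antidiagonal, mass_eq_one_iff (Nat.add_pos_left h.a_pos b)]

theorem mass_red : mass a b (a, b) = 1 := h.mem_antidiagonal_iff.1 (mem_antidiagonal.2 rfl)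

theorem mass_black : mass a b (c, d) = 1 :=
  h.mem_antidiagonal_iff.1 (mem_antidiagonal.2 h.balanced.symm)

theorem norm_limitChar_le_maxChar {u : ℕ × ℕ} (hu : mass a b u = 1) (r : ℝ) :
    ‖limitChar a b c d u (r ^ ratio a b c)‖ ≤ maxChar a b c d r :=
  Finset.le_sup' (fun u => ‖limitChar a b c d u (r ^ ratio a b c)‖) (h.mem_antidiagonal_iff.2 hu)

theorem continuous_limitChar_rpow {u : ℕ × ℕ} (hu : 0 < mass a b u) :
    Continuous fun r : ℝ => limitChar a b c d u (r ^ ratio a b c) :=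
  (h.continuous_limitChar hu).comp (Real.continuous_rpow_const h.ratio_pos.le)

theorem continuous_maxChar : Continuous (maxChar a b c d) :=
  Continuous.finset_sup'_apply _ fun _ hu =>
    (h.continuous_limitChar_rpow ((h.mem_antidiagonal_iff.1 hu).symm ▸ one_pos)).norm

theorem maxChar_le_one (r : ℝ) : maxChar a b c d r ≤ 1 :=
  Finset.sup'_le _ _ fun _ hu =>
    h.norm_limitChar_le_one ((h.mem_antidiagonal_iff.1 hu).symm ▸ one_pos) _

theorem eventually_maxChar_lt_one : ∀ᶠ r in 𝓝[>] 0, maxChar a b c d r < 1 := by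
  have hrpow : Tendsto (fun r : ℝ => r ^ ratio a b c) (𝓝[>] 0) (𝓝[≠] 0) := by
    refine tendsto_nhdsWithin_iff.2 ⟨?_, ?_⟩
    · have := (Real.continuous_rpow_const h.ratio_pos.le).tendsto (0 : ℝ)
      rw [Real.zero_rpow h.ratio_pos.ne'] at this
      exact this.mono_left nhdsWithin_le_nhds
    · filter_upwards [self_mem_nhdsWithin] with r hr
      exact (Real.rpow_pos_of_pos hr _).ne'
  have hall := (Filter.eventually_all_finset (antidiagonal (a + b))).2 fun u hu =>
    h.eventually_norm_limitChar_lt_one ((h.mem_antidiagonal_iff.1 hu).symm ▸ one_pos)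
  exact (hrpow.eventually hall).mono fun r hr => (Finset.sup'_lt_iff _).2 hr

theorem not_maxChar_ae_eq_one : ¬ maxChar a b c d =ᵐ[volume.restrict (Set.Ioi 0)] 1 := by
  intro hae
  obtain ⟨ε, hε, hlt⟩ := mem_nhdsGT_iff_exists_Ioo_subset.1 h.eventually_maxChar_lt_one
  have hnull := ae_restrict_of_ae_restrict_of_subset Set.Ioo_subset_Ioi_self hae (s := Set.Ioo 0 ε)
  have : (ae (volume.restrict (Set.Ioo 0 ε))).NeBot := ae_restrict_neBot.2 (by simpa using hε)
  obtain ⟨r, hr, hmem⟩ := (hnull.and (ae_restrict_mem measurableSet_Ioo)).exists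
  exact (hlt hmem).ne hr

theorem norm_limitChar_le_of_step {u : ℕ × ℕ} (hu : 0 < mass a b u) {t C : ℝ}
    (hred : ‖limitChar a b c d (u + (a, b)) t‖ ≤ C)
    (hblack : ‖limitChar a b c d (u + (c, d)) t‖ ≤ C) : ‖limitChar a b c d u t‖ ≤ C := by
  rw [h.limitChar_eq_one_step hu t, ← mem_closedBall_zero_iff]
  exact convex_closedBall (0 : ℂ) C (mem_closedBall_zero_iff.2 hred)
    (mem_closedBall_zero_iff.2 hblack) (probRed_nonneg u) (probBlack_nonneg u)
    (probRed_add_probBlack hu)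

theorem mul_norm_limitChar_add_rpow_le {v w : ℕ × ℕ} (hv : 1 ≤ mass a b v) (hw : mass a b w = 1)
    {r : ℝ} (hr : 0 < r) :
    r * ‖limitChar a b c d (v + w) (r ^ ratio a b c)‖ ≤
      mass a b v * ∫ s in (0 : ℝ)..r, ‖limitChar a b c d v (s ^ ratio a b c)‖ *
        ‖limitChar a b c d w ((r - s) ^ ratio a b c)‖ := by
  refine (mul_le_mul_of_nonneg_left (h.norm_limitChar_add_le hv hw _) hr.le).trans_eq ?_
  have hsubst := intervalIntegral.smul_integral_comp_mul_left (a := 0) (b := 1)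
    (fun s => ‖limitChar a b c d v (s ^ ratio a b c)‖ *
      ‖limitChar a b c d w ((r - s) ^ ratio a b c)‖) r
  rw [mul_zero, mul_one, smul_eq_mul] at hsubst
  rw [← hsubst, mul_left_comm]
  congr 2
  refine intervalIntegral.integral_congr fun s hs => ?_
  rw [Set.uIcc_of_le zero_le_one] at hs
  rw [← Real.mul_rpow hr.le hs.1, ← Real.mul_rpow hr.le (sub_nonneg.2 hs.2), mul_sub, mul_one]

theorem mul_maxChar_le_convolution {r : ℝ} (hr : 0 < r) :
    r * maxChar a b c d r ≤ ∫ s in (0 : ℝ)..r, maxChar a b c d s * maxChar a b c d (r - s) := by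
  have hadd : ∀ v w : ℕ × ℕ, mass a b v = 1 → mass a b w = 1 →
      ‖limitChar a b c d (v + w) (r ^ ratio a b c)‖ ≤
        (∫ s in (0 : ℝ)..r, maxChar a b c d s * maxChar a b c d (r - s)) / r := by
    intro v w hv hw
    have hle := h.mul_norm_limitChar_add_rpow_le hv.ge hw hr
    rw [hv, one_mul] at hle
    rw [le_div_iff₀' hr]
    have hsub := continuous_sub_left r
    refine hle.trans (intervalIntegral.integral_mono_on hr.le
      (Continuous.intervalIntegrable ?_ _ _) (Continuous.intervalIntegrable ?_ _ _) fun s _ =>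
      mul_le_mul (h.norm_limitChar_le_maxChar hv s) (h.norm_limitChar_le_maxChar hw (r - s))
        (norm_nonneg _) (maxChar_nonneg ..))
    · exact (h.continuous_limitChar_rpow (hv.symm ▸ one_pos)).norm.mul
        ((h.continuous_limitChar_rpow (hw.symm ▸ one_pos)).comp hsub).norm
    · exact h.continuous_maxChar.mul (h.continuous_maxChar.comp hsub)
  rw [← le_div_iff₀' hr]
  refine Finset.sup'_le _ _ fun u hu => ?_
  replace hu := h.mem_antidiagonal_iff.1 hu
  exact h.norm_limitChar_le_of_step (hu.symm ▸ one_pos) (hadd u (a, b) hu h.mass_red)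
    (hadd u (c, d) hu h.mass_black)

theorem integrableOn_maxChar : IntegrableOn (maxChar a b c d) (Set.Ioi 0) :=
  integrableOn_Ioi_of_mul_le_convolution h.continuous_maxChar.measurable (maxChar_nonneg a b c d)
    h.maxChar_le_one h.not_maxChar_ae_eq_one fun _ => h.mul_maxChar_le_convolution

theorem mul_norm_limitChar_add_rpow_le_integral_maxChar {v w : ℕ × ℕ} (hv : 1 ≤ mass a b v)
    (hw : mass a b w = 1) {r : ℝ} (hr : 0 < r) :
    r * ‖limitChar a b c d (v + w) (r ^ ratio a b c)‖ ≤
      mass a b v * ∫ s in Set.Ioi 0, maxChar a b c d s := by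
  have hv0 : 0 < mass a b v := one_pos.trans_le hv
  have hsub := continuous_sub_left r
  refine (h.mul_norm_limitChar_add_rpow_le hv hw hr).trans
    (mul_le_mul_of_nonneg_left ?_ hv0.le)
  calc _ ≤ ∫ s in (0 : ℝ)..r, maxChar a b c d (r - s) := by
        refine intervalIntegral.integral_mono_on hr.le (Continuous.intervalIntegrable ?_ _ _)
          (Continuous.intervalIntegrable (h.continuous_maxChar.comp hsub) _ _) fun s _ =>
          (mul_le_of_le_one_left (norm_nonneg _) (h.norm_limitChar_le_one hv0 _)).trans
            (h.norm_limitChar_le_maxChar hw _)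
        exact (h.continuous_limitChar_rpow hv0).norm.mul
          ((h.continuous_limitChar_rpow (hw.symm ▸ one_pos)).comp hsub).norm
    _ = ∫ s in Set.Ioc 0 r, maxChar a b c d s := by
        rw [intervalIntegral.integral_comp_sub_left (maxChar a b c d), sub_self, sub_zero,
          intervalIntegral.integral_of_le hr.le]
    _ ≤ ∫ s in Set.Ioi 0, maxChar a b c d s :=
        setIntegral_mono_set h.integrableOn_maxChar (.of_forall fun s => maxChar_nonneg a b c d s)
          Set.Ioc_subset_Ioi_self.eventuallyLE

theorem isBigO_limitChar_of_one_le {u : ℕ × ℕ} (hu : 1 ≤ mass a b u) :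
    limitChar a b c d u =O[atTop] fun t => t ^ (-(ratio a b c)⁻¹) := by
  refine .of_bound (mass a b u * ∫ s in Set.Ioi 0, maxChar a b c d s) ?_
  filter_upwards [eventually_gt_atTop 0] with t ht
  have hr := Real.rpow_pos_of_pos ht (ratio a b c)⁻¹
  have hadd : ∀ w : ℕ × ℕ, mass a b w = 1 → ‖limitChar a b c d (u + w) t‖ ≤
      mass a b u * (∫ s in Set.Ioi 0, maxChar a b c d s) * ‖t ^ (-(ratio a b c)⁻¹)‖ := by
    intro w hw
    have hle := h.mul_norm_limitChar_add_rpow_le_integral_maxChar hu hw hr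
    rw [Real.rpow_inv_rpow ht.le h.ratio_pos.ne'] at hle
    rwa [Real.rpow_neg ht.le, norm_inv, Real.norm_of_nonneg hr.le, ← div_eq_mul_inv,
      le_div_iff₀' hr]
  exact h.norm_limitChar_le_of_step (one_pos.trans_le hu) (hadd _ h.mass_red) (hadd _ h.mass_black)

theorem isBigO_limitChar {u : ℕ × ℕ} (hu : 0 < mass a b u) :
    limitChar a b c d u =O[atTop] fun t => t ^ (-(ratio a b c)⁻¹) := by
  have hred := h.isBigO_limitChar_of_one_le (u := u + (a, b)) (by rw [mass_add_red hu]; linarith)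
  have hblack := h.isBigO_limitChar_of_one_le (u := u + (c, d))
    (by rw [mass_add_black h.balanced hu]; linarith)
  exact ((hred.const_smul_left (probRed u)).add (hblack.const_smul_left (probBlack u))).congr_left
    fun t => (h.limitChar_eq_one_step hu t).symm

theorem integrable_charFun_of_eq_limitChar {u : ℕ × ℕ} (hu : 0 < mass a b u) {μ : Measure ℝ}
    (hμ : charFun μ = limitChar a b c d u) : Integrable (charFun μ) := by
  refine (hμ ▸ h.continuous_limitChar hu).locallyIntegrable
    |>.integrable_of_isBigO_atTop_of_norm_isNegInvariant
      (.of_forall fun t => by simp [charFun_neg]) (hμ ▸ h.isBigO_limitChar hu)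
      (integrableAtFilter_rpow_atTop_iff.2 ?_)
  exact neg_lt_neg ((one_lt_inv₀ h.ratio_pos).2 h.ratio_lt_one)

end IsLarge

end Decay

section Martingale

/-- `u₂` rescaled so that, along an urn process of initial mass `p`, it is a martingale. -/
noncomputable def rescaled (a b c : ℕ) (p : ℝ) (n : ℕ) (u : ℕ × ℕ) : ℝ :=
  1 / growth (ratio a b c) p n * u₂ a b c u

theorem mul_sub_sq_add_mul_sub_sq_le {p q x y m : ℝ} (hp : 0 ≤ p) (hq : 0 ≤ q) (hpq : p + q = 1)
    (hmean : p * x + q * y = m) (z : ℝ) :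
    p * (x - z) ^ 2 + q * (y - z) ^ 2 ≤ (m - z) ^ 2 + (x - y) ^ 2 := by
  have hcentered : p * (x - m) + q * (y - m) = 0 := by linear_combination hmean - m * hpq
  calc p * (x - z) ^ 2 + q * (y - z) ^ 2
      = (m - z) ^ 2 + (p * (x - m) ^ 2 + q * (y - m) ^ 2) := by
        linear_combination 2 * (m - z) * hmean + (z ^ 2 - m ^ 2) * hpq
    _ = (m - z) ^ 2 + p * q * (x - y) ^ 2 := by
        rw [mul_sq_add_mul_sq_of_mean_zero hpq hcentered, sub_sub_sub_cancel_right]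
    _ ≤ (m - z) ^ 2 + (x - y) ^ 2 := by
        gcongr
        exact mul_le_of_le_one_left (sq_nonneg _) (mul_le_one₀ (by linarith) hq (by linarith))

namespace IsLarge

variable {a b c d : ℕ} (h : IsLarge a b c d) {p : ℝ} (hp : 0 < p)
include h hp

theorem transitionOp_rescaled {n : ℕ} {u : ℕ × ℕ} (hu : mass a b u = p + n) :
    transitionOp a b c d ℝ (rescaled a b c p (n + 1)) u = rescaled a b c p n u := by
  have hu0 : 0 < mass a b u := hu ▸ by positivity
  rw [rescaled, ← one_div_growth_succ_mul h.ratio_pos.le hp n, ← hu, transitionOp_apply, rescaled,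
    rescaled, u₂_add, u₂_add, smul_eq_mul, smul_eq_mul]
  linear_combination 1 / growth (ratio a b c) p (n + 1) * (h.mean_increment hu0 +
    u₂ a b c u * probRed_add_probBlack hu0)

theorem transitionOp_sq_rescaled_sub_le {n : ℕ} {u : ℕ × ℕ} (hu : mass a b u = p + n) (z : ℝ) :
    transitionOp a b c d ℝ (fun v => (rescaled a b c p (n + 1) v - z) ^ 2) u ≤
      (rescaled a b c p n u - z) ^ 2 +
        jump a b c ^ 2 * (1 / growth (ratio a b c) p (n + 1) ^ 2) := by
  have hu0 : 0 < mass a b u := hu ▸ by positivity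
  refine (mul_sub_sq_add_mul_sub_sq_le (probRed_nonneg u) (probBlack_nonneg u)
    (probRed_add_probBlack hu0) (h.transitionOp_rescaled hp hu) z).trans_eq ?_
  rw [rescaled, rescaled, rescaled, u₂_add, u₂_add, ← h.u₂_red_sub_u₂_black]
  ring

theorem transitionOp_pow_sq_rescaled_sub_le (n k : ℕ) {u : ℕ × ℕ} (hu : mass a b u = p + n)
    (z : ℝ) :
    (transitionOp a b c d ℝ ^ k) (fun v => (rescaled a b c p (n + k) v - z) ^ 2) u ≤
      (rescaled a b c p n u - z) ^ 2 +
        jump a b c ^ 2 * ∑ j ∈ Finset.range k, 1 / growth (ratio a b c) p (j + (n + 1)) ^ 2 := by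
  induction k with
  | zero => simp
  | succ k ih =>
    rw [transitionOp_pow_succ_apply', Finset.sum_range_succ, mul_add]
    refine (transitionOp_pow_le_add h.balanced k (hu ▸ by positivity) fun v hv => ?_).trans
      ((add_le_add_left ih _).trans_eq (add_assoc ..))
    have hmass : mass a b v = p + (n + k : ℕ) := by
      rw [hv, hu]
      push_cast
      ring
    rw [show k + (n + 1) = n + k + 1 by ring]
    exact h.transitionOp_sq_rescaled_sub_le hp hmass z

theorem transitionOp_pow_sq_rescaled_sub_le_growthTail (n k : ℕ) {u : ℕ × ℕ}
    (hu : mass a b u = p + n) (z : ℝ) :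
    (transitionOp a b c d ℝ ^ k) (fun v => (rescaled a b c p (n + k) v - z) ^ 2) u ≤
      (rescaled a b c p n u - z) ^ 2 + jump a b c ^ 2 * growthTail (ratio a b c) p n := by
  refine (h.transitionOp_pow_sq_rescaled_sub_le hp n k hu z).trans ?_
  gcongr
  exact sum_one_div_growth_sq_le_growthTail h.half_lt_ratio hp n k

end IsLarge

end Martingale

section Trajectory

theorem hasSum_transition_smul {E : Type*} [AddCommGroup E] [Module ℝ E] [TopologicalSpace E]
    [ContinuousAdd E] (a b c d : ℕ) (f : ℕ × ℕ → E) (u : ℕ × ℕ) :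
    HasSum (fun v => transition a b c d u v • f v) (transitionOp a b c d E f u) := by
  have hite : ∀ (r : ℝ) (w : ℕ × ℕ),
      HasSum (fun v => (r * if v = w then 1 else 0) • f v) (r • f w) := fun r w => by
    simpa using hasSum_single (f := fun v => (r * if v = w then 1 else 0) • f v) w
      fun v hv => by rw [if_neg hv, mul_zero, zero_smul]
  have hsum := (hite (probRed u) (u + (a, b))).add (hite (probBlack u) (u + (c, d)))
  simp only [← add_smul] at hsum
  exact hsum

namespace IsProcess

variable {Ω : Type*} [mΩ : MeasurableSpace Ω] {μ : Measure Ω} {a b c d α β : ℕ}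
  {U : ℕ → Ω → ℕ × ℕ}

/-- The trajectory of the process `U` up to time `n`. -/
def past (U : ℕ → Ω → ℕ × ℕ) (n : ℕ) (ω : Ω) (k : Fin (n + 1)) : ℕ × ℕ := U k ω

section Markov

variable (hU : IsProcess μ a b c d α β U)
include hU

theorem measurable_past (n : ℕ) : Measurable (past U n) :=
  measurable_pi_lambda _ fun k => hU.measurable k

/-- The filtration generated by the urn process. -/
def filtration : Filtration ℕ mΩ where
  seq n := MeasurableSpace.comap (past U n) ⊤
  mono' n m hnm := by
    have hrestrict : past U n = (fun h k => h (Fin.castLE (by omega) k)) ∘ past U m := rfl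
    beta_reduce
    rw [hrestrict, ← MeasurableSpace.comap_comp]
    exact MeasurableSpace.comap_mono le_top
  le' n := by
    rintro _ ⟨B, -, rfl⟩
    exact hU.measurable_past n .of_discrete

theorem measurable_filtration {γ : Type*} [MeasurableSpace γ] (n : ℕ) (f : ℕ × ℕ → γ) :
    Measurable[hU.filtration n] fun ω => f (U n ω) :=
  fun s _ => ⟨(fun h => f (h (Fin.last n))) ⁻¹' s, trivial, rfl⟩

theorem measureReal_past_inter (n : ℕ) (h : Fin (n + 1) → ℕ × ℕ) (v : ℕ × ℕ) :
    μ.real (past U n ⁻¹' {h} ∩ U (n + 1) ⁻¹' {v}) =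
      μ.real (past U n ⁻¹' {h}) * transition a b c d (h (Fin.last n)) v := by
  have hextend : ∀ k : Fin (n + 1), h (Fin.ofNat (n + 1) k) = h k := fun k => by simp
  have hpast : past U n ⁻¹' {h} = {ω | ∀ k ≤ n, U k ω = h (Fin.ofNat (n + 1) k)} := by
    ext ω
    simp only [Set.mem_preimage, Set.mem_singleton_iff, funext_iff, past, Fin.forall_iff,
      Nat.lt_succ_iff, Set.mem_ofPred_eq]
    exact forall₂_congr fun k hk => by rw [← hextend ⟨k, Nat.lt_succ_iff.2 hk⟩]
  have hmarkov := hU.markov n (fun k => h (Fin.ofNat (n + 1) k)) v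
  rw [← hpast] at hmarkov
  rw [← hextend (Fin.last n), Fin.val_last, ← hmarkov, hpast]
  rfl

variable [IsFiniteMeasure μ]

theorem ae_succ (n : ℕ) :
    ∀ᵐ ω ∂μ, U (n + 1) ω = U n ω + (a, b) ∨ U (n + 1) ω = U n ω + (c, d) := by
  have hnull : ∀ᵐ ω ∂μ, ∀ (h : Fin (n + 1) → ℕ × ℕ) (v : ℕ × ℕ), v ≠ h (Fin.last n) + (a, b) →
      v ≠ h (Fin.last n) + (c, d) → ω ∉ past U n ⁻¹' {h} ∩ U (n + 1) ⁻¹' {v} := by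
    simp only [ae_all_iff]
    intro h v hred hblack
    have hzero := hU.measureReal_past_inter n h v
    rw [transition, if_neg hred, if_neg hblack, mul_zero, mul_zero, add_zero, mul_zero,
      measureReal_eq_zero_iff] at hzero
    exact measure_eq_zero_iff_ae_notMem.1 hzero
  filter_upwards [hnull] with ω hω
  by_contra! hne
  exact hω (past U n ω) (U (n + 1) ω) hne.1 hne.2 ⟨rfl, rfl⟩

variable (hS : a + b = c + d)
include hS

theorem ae_fst_add_snd (n : ℕ) : ∀ᵐ ω ∂μ, (U n ω).1 + (U n ω).2 = α + β + n * (a + b) := by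
  induction n with
  | zero => filter_upwards [hU.init] with ω hω; simp [hω]
  | succ n ih =>
    filter_upwards [ih, hU.ae_succ n] with ω htotal hstep
    rw [add_mul, one_mul, ← add_assoc, ← htotal]
    rcases hstep with hstep | hstep <;> rw [hstep] <;> simp only [Prod.fst_add, Prod.snd_add] <;>
      omega

theorem ae_mass (hαβ : 0 < mass a b (α, β)) (n : ℕ) :
    ∀ᵐ ω ∂μ, mass a b (U n ω) = mass a b (α, β) + n := by
  have := balance_pos hαβ
  filter_upwards [hU.ae_fst_add_snd hS n] with ω hω
  have hcast : ((U n ω).1 : ℝ) + (U n ω).2 = α + β + n * (a + b) := by exact_mod_cast hω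
  rw [mass, mass, hcast]
  field_simp

theorem integrable_comp {E : Type*} [NormedAddCommGroup E] (f : ℕ × ℕ → E) (n : ℕ) :
    Integrable (fun ω => f (U n ω)) μ := by
  refine .of_bound (StronglyMeasurable.of_discrete.comp_measurable
    (hU.measurable n)).aestronglyMeasurable
    (∑ v ∈ Finset.HasAntidiagonal.antidiagonal (α + β + n * (a + b)), ‖f v‖) ?_
  filter_upwards [hU.ae_fst_add_snd hS n] with ω hω
  exact Finset.single_le_sum (f := fun v => ‖f v‖) (fun _ _ => norm_nonneg _)
    (Finset.HasAntidiagonal.mem_antidiagonal.2 hω)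

variable {E : Type*} [NormedAddCommGroup E] [NormedSpace ℝ E] [CompleteSpace E]

theorem setIntegral_past (f : ℕ × ℕ → E) (n : ℕ) (h : Fin (n + 1) → ℕ × ℕ) :
    ∫ ω in past U n ⁻¹' {h}, f (U (n + 1) ω) ∂μ =
      ∫ ω in past U n ⁻¹' {h}, transitionOp a b c d E f (U n ω) ∂μ := by
  have hmeas : MeasurableSet (past U n ⁻¹' {h}) := hU.measurable_past n (measurableSet_singleton h)
  have hnow : Set.EqOn (fun ω => transitionOp a b c d E f (U n ω))
      (fun _ => transitionOp a b c d E f (h (Fin.last n))) (past U n ⁻¹' {h}) :=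
    fun ω hω => congrArg (transitionOp a b c d E f) (congrFun hω (Fin.last n))
  have hU' := (hU.measurable (n + 1)).aemeasurable (μ := μ.restrict (past U n ⁻¹' {h}))
  have hf {ν : Measure (ℕ × ℕ)} : AEStronglyMeasurable f ν :=
    StronglyMeasurable.of_discrete.aestronglyMeasurable
  have hlaw : ∀ v, ((μ.restrict (past U n ⁻¹' {h})).map (U (n + 1))).real {v} =
      μ.real (past U n ⁻¹' {h}) * transition a b c d (h (Fin.last n)) v := fun v => by
    rw [map_measureReal_apply (hU.measurable _) (measurableSet_singleton v),
      measureReal_restrict_apply (hU.measurable _ (measurableSet_singleton v)), Set.inter_comm,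
      hU.measureReal_past_inter]
  rw [setIntegral_congr_fun hmeas hnow, setIntegral_const, ← integral_map hU' hf,
    integral_countable ((integrable_map_measure hf hU').2
      (hU.integrable_comp hS f (n + 1)).integrableOn)]
  simp only [hlaw, mul_smul]
  exact ((hasSum_transition_smul a b c d f _).const_smul _).tsum_eq

theorem setIntegral_succ (f : ℕ × ℕ → E) (n : ℕ) {A : Set Ω}
    (hA : MeasurableSet[hU.filtration n] A) :
    ∫ ω in A, f (U (n + 1) ω) ∂μ = ∫ ω in A, transitionOp a b c d E f (U n ω) ∂μ := by
  obtain ⟨B, -, rfl⟩ := hA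
  have hdisjoint : Pairwise (Function.onFun Disjoint fun h : B => past U n ⁻¹' {h.1}) :=
    fun h h' hne => Disjoint.preimage _ (Set.disjoint_singleton.2 (Subtype.coe_ne_coe.2 hne))
  have hmeas : ∀ h : B, MeasurableSet (past U n ⁻¹' {h.1}) := fun h =>
    hU.measurable_past n (measurableSet_singleton _)
  rw [← Set.iUnion_of_singleton_coe B, Set.preimage_iUnion,
    integral_iUnion hmeas hdisjoint (hU.integrable_comp hS f _).integrableOn,
    integral_iUnion hmeas hdisjoint (hU.integrable_comp hS _ n).integrableOn]
  exact tsum_congr fun h => hU.setIntegral_past hS f n h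

theorem setIntegral_add (f : ℕ × ℕ → E) (n k : ℕ) {A : Set Ω}
    (hA : MeasurableSet[hU.filtration n] A) :
    ∫ ω in A, f (U (n + k) ω) ∂μ = ∫ ω in A, (transitionOp a b c d E ^ k) f (U n ω) ∂μ := by
  induction k generalizing f with
  | zero => rfl
  | succ k ih =>
    rw [← add_assoc, hU.setIntegral_succ hS f (n + k)
      (hU.filtration.mono (Nat.le_add_right n k) _ hA), ih]
    simp only [transitionOp_pow_succ_apply']

theorem setIntegral_preimage (f : ℕ × ℕ → E) (n k : ℕ) (v : ℕ × ℕ) :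
    ∫ ω in U n ⁻¹' {v}, f (U (n + k) ω) ∂μ =
      μ.real (U n ⁻¹' {v}) • (transitionOp a b c d E ^ k) f v := by
  have hA : MeasurableSet[hU.filtration n] (U n ⁻¹' {v}) :=
    hU.measurable_filtration n id (measurableSet_singleton v)
  rw [hU.setIntegral_add hS f n k hA,
    setIntegral_congr_fun (hU.measurable n (measurableSet_singleton v))
      (fun ω hω => congrArg ((transitionOp a b c d E ^ k) f) hω), setIntegral_const]

end Markov

theorem integral_comp [IsProbabilityMeasure μ] (hU : IsProcess μ a b c d α β U)
    (hS : a + b = c + d) {E : Type*} [NormedAddCommGroup E] [NormedSpace ℝ E] [CompleteSpace E]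
    (f : ℕ × ℕ → E) (n : ℕ) :
    ∫ ω, f (U n ω) ∂μ = (transitionOp a b c d E ^ n) f (α, β) := by
  have hstart : (fun ω => (transitionOp a b c d E ^ n) f (U 0 ω)) =ᵐ[μ]
      fun _ => (transitionOp a b c d E ^ n) f (α, β) := hU.init.mono fun ω hω => by simp only [hω]
  have hmarkov := hU.setIntegral_add hS f 0 n MeasurableSet.univ
  rw [zero_add, setIntegral_univ, setIntegral_univ] at hmarkov
  rw [hmarkov, integral_congr_ae hstart, integral_const, probReal_univ, one_smul]

end IsProcess

end Trajectory

section LimitVariable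

theorem IsLarge.isLimit_of_tendsto_rescaled {Ω : Type*} [MeasurableSpace Ω] {μ : Measure Ω}
    {a b c d : ℕ} (h : IsLarge a b c d) {U : ℕ → Ω → ℕ × ℕ} {p : ℝ} (hp : 0 < p) {M : Ω → ℝ}
    (hM : Measurable M)
    (hlim : ∀ᵐ ω ∂μ, Tendsto (fun n => rescaled a b c p n (U n ω)) atTop (𝓝 (M ω))) :
    IsLimit μ a b c U fun ω => growthConst (ratio a b c) p * M ω := by
  refine ⟨hM.const_mul _, ?_⟩
  filter_upwards [hlim] with ω hω
  refine ((tendsto_growth_div h.ratio_pos.le hp).mul hω).congr fun n => ?_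
  have := (growth_pos h.ratio_pos.le hp n).ne'
  rw [rescaled]
  field_simp

namespace IsProcess

variable {Ω : Type*} [MeasurableSpace Ω] {μ : Measure Ω} {a b c d α β : ℕ}
  {U : ℕ → Ω → ℕ × ℕ} (hU : IsProcess μ a b c d α β U) (h : IsLarge a b c d)
  (hαβ : 0 < mass a b (α, β))
include hU h hαβ

theorem martingale_rescaled [IsFiniteMeasure μ] :
    Martingale (fun n ω => rescaled a b c (mass a b (α, β)) n (U n ω)) hU.filtration μ := by
  have hmeas : ∀ n, StronglyMeasurable[hU.filtration n]
      fun ω => rescaled a b c (mass a b (α, β)) n (U n ω) := fun n =>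
    (hU.measurable_filtration n _).stronglyMeasurable
  have hint := fun n => hU.integrable_comp h.balanced (rescaled a b c (mass a b (α, β)) n) n
  refine martingale_nat hmeas hint fun n => ?_
  refine ae_eq_condExp_of_forall_setIntegral_eq (hU.filtration.le n) (hint (n + 1))
    (fun _ _ _ => (hint n).integrableOn) (fun A hA _ => ?_) (hmeas n).aestronglyMeasurable
  rw [hU.setIntegral_succ h.balanced (rescaled a b c (mass a b (α, β)) (n + 1)) n hA]
  refine integral_congr_ae (ae_restrict_of_ae ?_)
  filter_upwards [hU.ae_mass h.balanced hαβ n] with ω hω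
  exact (h.transitionOp_rescaled hαβ hω).symm

variable [IsProbabilityMeasure μ]

theorem integral_sq_rescaled_le (n : ℕ) :
    ∫ ω, rescaled a b c (mass a b (α, β)) n (U n ω) ^ 2 ∂μ ≤ u₂ a b c (α, β) ^ 2 +
      jump a b c ^ 2 * growthTail (ratio a b c) (mass a b (α, β)) 0 := by
  rw [hU.integral_comp h.balanced fun v => rescaled a b c (mass a b (α, β)) n v ^ 2]
  simpa [rescaled] using
    h.transitionOp_pow_sq_rescaled_sub_le_growthTail hαβ 0 n (u := (α, β)) (by simp) 0

theorem exists_eLpNorm_rescaled_le : ∃ R : NNReal, ∀ n,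
    eLpNorm (fun ω => rescaled a b c (mass a b (α, β)) n (U n ω)) 1 μ ≤ R := by
  refine ⟨(1 + (u₂ a b c (α, β) ^ 2 +
    jump a b c ^ 2 * growthTail (ratio a b c) (mass a b (α, β)) 0)).toNNReal, fun n => ?_⟩
  have hint := hU.integrable_comp h.balanced (rescaled a b c (mass a b (α, β)) n) n
  have hintsq :=
    hU.integrable_comp h.balanced (fun v => rescaled a b c (mass a b (α, β)) n v ^ 2) n
  rw [eLpNorm_one_eq_lintegral_enorm, ← ofReal_integral_norm_eq_lintegral_enorm hint]
  refine ENNReal.ofReal_le_ofReal ?_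
  calc _ ≤ ∫ ω, 1 + rescaled a b c (mass a b (α, β)) n (U n ω) ^ 2 ∂μ := by
        refine integral_mono hint.norm ((integrable_const _).add hintsq) fun ω => ?_
        rw [Real.norm_eq_abs, ← sq_abs (rescaled a b c (mass a b (α, β)) n (U n ω))]
        nlinarith [sq_nonneg (|rescaled a b c (mass a b (α, β)) n (U n ω)| - 1)]
    _ ≤ _ := by
        rw [integral_add (integrable_const _) hintsq, integral_const, probReal_univ, one_smul]
        exact add_le_add_right (hU.integral_sq_rescaled_le h hαβ n) _

theorem exists_tendsto_rescaled : ∃ M : Ω → ℝ, Measurable M ∧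
    ∀ᵐ ω ∂μ, Tendsto (fun n => rescaled a b c (mass a b (α, β)) n (U n ω)) atTop (𝓝 (M ω)) := by
  obtain ⟨R, hR⟩ := hU.exists_eLpNorm_rescaled_le h hαβ
  exact measurable_limit_of_tendsto_metrizable_ae
    (fun n => (hU.integrable_comp h.balanced (rescaled a b c _ n) n).aemeasurable)
    ((hU.martingale_rescaled h hαβ).submartingale.exists_ae_tendsto_of_bdd hR)

theorem charFun_map_eq_limitChar {W : Ω → ℝ} (hW : IsLimit μ a b c U W) :
    charFun (μ.map W) = limitChar a b c d (α, β) := by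
  ext t
  rw [charFun_apply_real, integral_map hW.1.aemeasurable (by fun_prop)]
  refine tendsto_nhds_unique ?_ (h.tendsto_charSeq_div_rpow hαβ t)
  simp only [charSeq, ← hU.integral_comp h.balanced]
  refine tendsto_integral_of_dominated_convergence (fun _ => 1)
    (fun n => (hU.integrable_comp h.balanced _ n).aestronglyMeasurable) (integrable_const _)
    (fun n => .of_forall fun ω => (norm_wave ..).le) ?_
  filter_upwards [hW.2] with ω hω
  have hexp : Continuous fun x : ℝ => Complex.exp ((t * x : ℝ) * Complex.I) := by fun_prop
  refine (((hexp.tendsto _).comp hω).congr fun n => ?_).trans_eq (by push_cast; rfl)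
  rw [Function.comp_apply, wave, mul_div_assoc', div_mul_eq_mul_div]

end IsProcess

end LimitVariable

section Reachability

theorem exists_add_eq_abs_sub_le {X Y : ℝ} (hX : 0 < X) (hY : 0 < Y) {n : ℕ} {z : ℝ}
    (hlow : -(n * Y) ≤ z) (hhigh : z ≤ n * X) :
    ∃ i j : ℕ, i + j = n ∧ |i * X - j * Y - z| ≤ X + Y := by
  set r := (z + n * Y) / (X + Y)
  have hr : r * (X + Y) = z + n * Y := div_mul_cancel₀ _ (by positivity)
  have hr0 : 0 ≤ r := div_nonneg (by linarith) (by positivity)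
  have hfloor : ⌊r⌋₊ ≤ n := Nat.floor_le_of_le ((div_le_iff₀ (by positivity)).2 (by linarith))
  refine ⟨⌊r⌋₊, n - ⌊r⌋₊, Nat.add_sub_of_le hfloor, ?_⟩
  have hrewrite : ⌊r⌋₊ * X - ((n - ⌊r⌋₊ : ℕ) : ℝ) * Y - z = -((r - ⌊r⌋₊) * (X + Y)) := by
    rw [Nat.cast_sub hfloor]
    linear_combination hr
  rw [hrewrite, abs_neg, abs_mul, abs_of_pos (add_pos hX hY)]
  refine mul_le_of_le_one_left (by positivity) ?_
  rw [abs_of_nonneg (sub_nonneg.2 (Nat.floor_le hr0))]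
  linarith [Nat.lt_floor_add_one r]

variable {a b c d : ℕ}

theorem transitionOp_pow_succ_pos_of_red {f : ℕ × ℕ → ℝ} (hf : ∀ v, 0 ≤ f v) {n : ℕ} {u : ℕ × ℕ}
    (hu : 0 < u.1) (hpos : 0 < (transitionOp a b c d ℝ ^ n) f (u + (a, b))) :
    0 < (transitionOp a b c d ℝ ^ (n + 1)) f u := by
  rw [transitionOp_pow_succ_apply]
  exact add_pos_of_pos_of_nonneg (mul_pos (probRed_pos hu) hpos)
    (mul_nonneg (probBlack_nonneg u) (transitionOp_pow_nonneg hf n _))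

theorem transitionOp_pow_succ_pos_of_black {f : ℕ × ℕ → ℝ} (hf : ∀ v, 0 ≤ f v) {n : ℕ} {u : ℕ × ℕ}
    (hu : 0 < u.2) (hpos : 0 < (transitionOp a b c d ℝ ^ n) f (u + (c, d))) :
    0 < (transitionOp a b c d ℝ ^ (n + 1)) f u := by
  rw [transitionOp_pow_succ_apply]
  exact add_pos_of_nonneg_of_pos (mul_nonneg (probRed_nonneg u) (transitionOp_pow_nonneg hf n _))
    (mul_pos (probBlack_pos hu) hpos)

theorem transitionOp_pow_add_pos {f : ℕ × ℕ → ℝ} (hf : ∀ v, 0 ≤ f v) (i j : ℕ) {u : ℕ × ℕ}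
    (hred : 0 < u.1) (hblack : 0 < u.2) (hpos : 0 < f (u + i • (a, b) + j • (c, d))) :
    0 < (transitionOp a b c d ℝ ^ (i + j)) f u := by
  induction i generalizing u with
  | zero =>
    rw [zero_smul, add_zero] at hpos
    rw [zero_add]
    induction j generalizing u with
    | zero => simpa using hpos
    | succ j ih =>
      refine transitionOp_pow_succ_pos_of_black hf hblack
        (ih (Nat.add_pos_left hred _) (Nat.add_pos_left hblack _) ?_)
      rwa [add_assoc, ← succ_nsmul']
  | succ i ih =>
    rw [add_right_comm]
    refine transitionOp_pow_succ_pos_of_red hf hred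
      (ih (Nat.add_pos_left hred _) (Nat.add_pos_left hblack _) ?_)
    rwa [add_assoc u, ← succ_nsmul']

theorem u₂_add_nsmul (u : ℕ × ℕ) (i j : ℕ) :
    u₂ a b c (u + i • (a, b) + j • (c, d)) =
      u₂ a b c u + i * u₂ a b c (a, b) + j * u₂ a b c (c, d) := by
  simp only [u₂, Prod.fst_add, Prod.snd_add, Prod.smul_fst, Prod.smul_snd, smul_eq_mul,
    Nat.cast_add, Nat.cast_mul]
  ring

namespace IsLarge

variable (h : IsLarge a b c d)
include h

theorem mass_add_nsmul (u : ℕ × ℕ) (i j : ℕ) :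
    mass a b (u + i • (a, b) + j • (c, d)) = mass a b u + (i + j : ℕ) := by
  have hS : (c : ℝ) + d = a + b := by exact_mod_cast h.balanced.symm
  have hpos : (0 : ℝ) < a + b := by have := h.b_pos; positivity
  simp only [mass, Prod.fst_add, Prod.snd_add, Prod.smul_fst, Prod.smul_snd, smul_eq_mul,
    Nat.cast_add, Nat.cast_mul]
  field_simp
  linear_combination (j : ℝ) * hS

theorem exists_transitionOp_pow_succ_pos {u : ℕ × ℕ} (hu : 0 < mass a b u) :
    ∃ v : ℕ × ℕ, mass a b v = mass a b u + 1 ∧ 0 < v.1 ∧ 0 < v.2 ∧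
      ∀ f : ℕ × ℕ → ℝ, (∀ w, 0 ≤ f w) → ∀ n, 0 < (transitionOp a b c d ℝ ^ n) f v →
        0 < (transitionOp a b c d ℝ ^ (n + 1)) f u := by
  rcases Nat.eq_zero_or_pos u.1 with hred | hred
  · have hblack : 0 < u.2 := by simpa [hred] using total_pos hu
    exact ⟨u + (c, d), mass_add_black h.balanced hu, Nat.add_pos_right _ h.c_pos,
      Nat.add_pos_right _ h.d_pos, fun f hf n => transitionOp_pow_succ_pos_of_black hf hblack⟩
  · exact ⟨u + (a, b), mass_add_red hu, Nat.add_pos_right _ h.a_pos,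
      Nat.add_pos_right _ h.b_pos, fun f hf n => transitionOp_pow_succ_pos_of_red hf hred⟩

theorem eventually_exists_rescaled_add_nsmul_near {p : ℝ} (hp : 0 < p) (u : ℕ × ℕ) (y : ℝ) {δ : ℝ}
    (hδ : 0 < δ) : ∀ᶠ n : ℕ in atTop, ∃ i j : ℕ, i + j = n ∧
      |rescaled a b c p (n + 1) (u + i • (a, b) + j • (c, d)) - y| < δ := by
  have hσ := h.ratio_pos
  have hX : 0 < u₂ a b c (a, b) := by have := h.b_pos; rw [u₂_red]; positivity
  have hY : 0 < -u₂ a b c (c, d) := by have := h.c_pos; rw [h.u₂_black, neg_neg]; positivity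
  have hdrift : Tendsto (fun n : ℕ => growth (ratio a b c) p (n + 1) / n * y - u₂ a b c u / n)
      atTop (𝓝 0) := by
    simpa using ((tendsto_growth_succ_div_self hσ.le h.ratio_lt_one hp).mul_const y).sub
      (tendsto_const_div_atTop_nhds_zero_nat (u₂ a b c u))
  have hgap : Tendsto (fun n : ℕ => (u₂ a b c (a, b) + -u₂ a b c (c, d)) /
      growth (ratio a b c) p (n + 1)) atTop (𝓝 0) :=
    tendsto_const_nhds.div_atTop ((tendsto_growth_atTop hσ hp).comp (tendsto_add_atTop_nat 1))
  filter_upwards [hdrift.eventually (Icc_mem_nhds (neg_lt_zero.2 hY) hX),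
    hgap.eventually (gt_mem_nhds hδ), eventually_gt_atTop 0] with n ⟨hlow, hhigh⟩ hsmall hn
  have hn' : (0 : ℝ) < n := by exact_mod_cast hn
  have hγ := growth_pos hσ.le hp (n + 1)
  set γ := growth (ratio a b c) p (n + 1) with hγ_def
  have hcombine : γ / n * y - u₂ a b c u / n = (γ * y - u₂ a b c u) / n := by ring
  rw [hcombine, le_div_iff₀ hn'] at hlow
  rw [hcombine, div_le_iff₀ hn'] at hhigh
  obtain ⟨i, j, hij, hclose⟩ := exists_add_eq_abs_sub_le hX hY (n := n) (by linarith)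
    (hhigh.trans_eq (mul_comm _ _))
  refine ⟨i, j, hij, lt_of_le_of_lt ?_ hsmall⟩
  rw [le_div_iff₀ hγ, rescaled, u₂_add_nsmul, ← hγ_def, ← abs_of_pos hγ, ← abs_mul,
    abs_of_pos hγ]
  refine le_of_eq_of_le (congrArg _ ?_) hclose
  field_simp
  ring

end IsLarge

end Reachability

section Support

namespace IsProcess

variable {Ω : Type*} [MeasurableSpace Ω] {μ : Measure Ω} {a b c d α β : ℕ}
  {U : ℕ → Ω → ℕ × ℕ} (hU : IsProcess μ a b c d α β U) (h : IsLarge a b c d)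
  (hαβ : 0 < mass a b (α, β))
include hU h hαβ

theorem setIntegral_sq_rescaled_sub_le [IsFiniteMeasure μ] (n k : ℕ) {v : ℕ × ℕ}
    (hv : mass a b v = mass a b (α, β) + n) :
    ∫ ω in U n ⁻¹' {v}, (rescaled a b c (mass a b (α, β)) (n + k) (U (n + k) ω) -
        rescaled a b c (mass a b (α, β)) n v) ^ 2 ∂μ ≤
      μ.real (U n ⁻¹' {v}) *
        (jump a b c ^ 2 * growthTail (ratio a b c) (mass a b (α, β)) n) := by
  rw [hU.setIntegral_preimage h.balanced (fun w => (rescaled a b c (mass a b (α, β)) (n + k) w -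
    rescaled a b c (mass a b (α, β)) n v) ^ 2) n k v]
  refine mul_le_mul_of_nonneg_left ?_ measureReal_nonneg
  simpa using h.transitionOp_pow_sq_rescaled_sub_le_growthTail hαβ n k hv
    (rescaled a b c (mass a b (α, β)) n v)

theorem setLIntegral_sq_sub_rescaled_le [IsFiniteMeasure μ] {M : Ω → ℝ}
    (hlim : ∀ᵐ ω ∂μ, Tendsto (fun n => rescaled a b c (mass a b (α, β)) n (U n ω)) atTop
      (𝓝 (M ω))) (n : ℕ) {v : ℕ × ℕ} (hv : mass a b v = mass a b (α, β) + n) :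
    ∫⁻ ω in U n ⁻¹' {v}, ENNReal.ofReal ((M ω - rescaled a b c (mass a b (α, β)) n v) ^ 2) ∂μ ≤
      ENNReal.ofReal (μ.real (U n ⁻¹' {v}) *
        (jump a b c ^ 2 * growthTail (ratio a b c) (mass a b (α, β)) n)) := by
  set p := mass a b (α, β)
  set m := rescaled a b c p n v
  have hint := fun k => (hU.integrable_comp h.balanced
    (fun w => (rescaled a b c p (n + k) w - m) ^ 2) (n + k)).restrict (s := U n ⁻¹' {v})
  have hliminf : ∀ᵐ ω ∂μ.restrict (U n ⁻¹' {v}), ENNReal.ofReal ((M ω - m) ^ 2) =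
      liminf (fun k => ENNReal.ofReal ((rescaled a b c p (n + k) (U (n + k) ω) - m) ^ 2))
        atTop := by
    filter_upwards [ae_restrict_of_ae hlim] with ω hω
    have hshift : Tendsto (fun k => rescaled a b c p (n + k) (U (n + k) ω)) atTop (𝓝 (M ω)) := by
      simpa only [add_comm n] using (tendsto_add_atTop_iff_nat n).2 hω
    exact (ENNReal.tendsto_ofReal ((hshift.sub_const m).pow 2)).liminf_eq.symm
  rw [lintegral_congr_ae hliminf]
  refine (lintegral_liminf_le' fun k => (hint k).aemeasurable.ennreal_ofReal).trans
    (liminf_le_of_frequently_le' (.of_forall fun k => ?_))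
  rw [← ofReal_integral_eq_lintegral_ofReal (hint k) (.of_forall fun _ => sq_nonneg _)]
  exact ENNReal.ofReal_le_ofReal (hU.setIntegral_sq_rescaled_sub_le h hαβ n k hv)

variable [IsProbabilityMeasure μ]

theorem exists_reachable_near (y : ℝ) {δ : ℝ} (hδ : 0 < δ) :
    ∃ n v, 0 < μ.real (U n ⁻¹' {v}) ∧ mass a b v = mass a b (α, β) + n ∧
      |rescaled a b c (mass a b (α, β)) n v - y| < δ ∧
      jump a b c ^ 2 * growthTail (ratio a b c) (mass a b (α, β)) n < δ ^ 2 := by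
  obtain ⟨u, hu, hred, hblack, hreach⟩ := h.exists_transitionOp_pow_succ_pos hαβ
  have htail : Tendsto (fun n => jump a b c ^ 2 *
      growthTail (ratio a b c) (mass a b (α, β)) (n + 1)) atTop (𝓝 0) := by
    simpa using ((tendsto_growthTail _ _).comp (tendsto_add_atTop_nat 1)).const_mul (jump a b c ^ 2)
  obtain ⟨_, ⟨i, j, rfl, hnear⟩, hsmall⟩ :=
    ((h.eventually_exists_rescaled_add_nsmul_near hαβ u y hδ).and
      (htail.eventually (gt_mem_nhds (pow_pos hδ 2)))).exists
  refine ⟨i + j + 1, u + i • (a, b) + j • (c, d), ?_, ?_, hnear, hsmall⟩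
  · rw [← integral_indicator_one (hU.measurable _ (measurableSet_singleton _))]
    refine (hreach (Set.indicator {u + i • (a, b) + j • (c, d)} 1) ?_ _ ?_).trans_eq
      (hU.integral_comp h.balanced _ _).symm
    · exact fun w => Set.indicator_nonneg (fun _ _ => zero_le_one) w
    · exact transitionOp_pow_add_pos (fun w => Set.indicator_nonneg (fun _ _ => zero_le_one) w) i j
        hred hblack (by simp)
  · rw [h.mass_add_nsmul, hu]
    push_cast
    ring

theorem not_ae_le_abs_sub {M : Ω → ℝ}
    (hlim : ∀ᵐ ω ∂μ, Tendsto (fun n => rescaled a b c (mass a b (α, β)) n (U n ω)) atTop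
      (𝓝 (M ω))) (y : ℝ) {δ : ℝ} (hδ : 0 < δ) : ¬ ∀ᵐ ω ∂μ, δ ≤ |M ω - y| := by
  intro hfar
  obtain ⟨n, v, hpos, hmass, hnear, hsmall⟩ := hU.exists_reachable_near h hαβ y (half_pos hδ)
  have hupper := hU.setLIntegral_sq_sub_rescaled_le h hαβ hlim n hmass
  set m := rescaled a b c (mass a b (α, β)) n v
  have hlower : ENNReal.ofReal (μ.real (U n ⁻¹' {v}) * (δ / 2) ^ 2) ≤
      ∫⁻ ω in U n ⁻¹' {v}, ENNReal.ofReal ((M ω - m) ^ 2) ∂μ := by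
    rw [mul_comm, ENNReal.ofReal_mul (by positivity), ofReal_measureReal, ← setLIntegral_const]
    refine lintegral_mono_ae (ae_restrict_of_ae ?_)
    filter_upwards [hfar] with ω hω
    refine ENNReal.ofReal_le_ofReal (sq_le_sq.2 ?_)
    rw [abs_of_pos (half_pos hδ)]
    linarith [abs_sub_le (M ω) m y]
  have hle := hlower.trans hupper
  rw [ENNReal.ofReal_le_ofReal_iff (mul_nonneg hpos.le
    (mul_nonneg (sq_nonneg _) (growthTail_nonneg ..)))] at hle
  exact hle.not_gt (mul_lt_mul_of_pos_left hsmall hpos)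

theorem support_map_eq_univ {M : Ω → ℝ} (hM : Measurable M)
    (hlim : ∀ᵐ ω ∂μ, Tendsto (fun n => rescaled a b c (mass a b (α, β)) n (U n ω)) atTop
      (𝓝 (M ω))) {κ : ℝ} (hκ : 0 < κ) :
    (μ.map fun ω => κ * M ω).support = Set.univ := by
  refine Set.eq_univ_of_forall fun x => ?_
  by_contra hx
  obtain ⟨V, hV, hV0⟩ := Measure.notMem_support_iff_exists.1 hx
  obtain ⟨ε, hε, hball⟩ := Metric.mem_nhds_iff.1 hV
  have hnull := measure_mono_null hball hV0
  rw [Measure.map_apply (hM.const_mul _) Metric.isOpen_ball.measurableSet] at hnull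
  refine hU.not_ae_le_abs_sub h hαβ hlim (x / κ) (div_pos hε hκ) ?_
  filter_upwards [measure_eq_zero_iff_ae_notMem.1 hnull] with ω hω
  have hdist : ε ≤ |κ * M ω - x| := by simpa [Real.dist_eq] using hω
  rwa [div_le_iff₀' hκ, ← abs_of_pos hκ, ← abs_mul, abs_of_pos hκ, mul_sub,
    mul_div_cancel₀ _ hκ.ne']

end IsProcess

end Support

end PolyaUrn

theorem mainTheorem6
    (a b c d : ℕ) (hbalanced : a + b = c + d) (hb : b ≠ 0) (hc : c ≠ 0)
    (hlarge : 1 / 2 < PolyaUrn.ratio a b c)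
    (α β : ℕ) (hαβ : (α, β) ≠ (0, 0))
    {Ω : Type*} [MeasurableSpace Ω] (μ : Measure Ω) [IsProbabilityMeasure μ]
    (U : ℕ → Ω → ℕ × ℕ) (hU : PolyaUrn.IsProcess μ a b c d α β U) :
    ∃ W : Ω → ℝ, PolyaUrn.IsLimit μ a b c U W ∧
      (∃ f : ℝ → ℝ, Continuous f ∧ (∀ x, 0 ≤ f x) ∧ (∃ C : ℝ, ∀ x, f x ≤ C) ∧
        μ.map W = volume.withDensity (fun x => ENNReal.ofReal (f x))) ∧
      (μ.map W).support = Set.univ := by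
  have h : PolyaUrn.IsLarge a b c d := ⟨hbalanced, hb, hc, hlarge⟩
  have hmass := h.mass_pos hαβ
  obtain ⟨M, hM, hlim⟩ := hU.exists_tendsto_rescaled h hmass
  have hW := h.isLimit_of_tendsto_rescaled hmass hM hlim
  have hchar := h.integrable_charFun_of_eq_limitChar hmass (hU.charFun_map_eq_limitChar h hmass hW)
  exact ⟨_, hW, PolyaUrn.exists_continuous_density_of_integrable_charFun hchar,
    hU.support_map_eq_univ h hmass hM hlim (PolyaUrn.growthConst_pos h.ratio_pos.le hmass)⟩
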